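/- Fix pairwise disjoint, countably infinite sets $N_C, N_R, N_I, N_V$ of concept names, role names, individual names and provenance variables. Concepts are built by $C ::= A \mid \exists R.C \mid C\sqcap C\mid\top$, and an axiom is a GCI $C\sqsubseteq D$ with $D ::= A\mid\exists R$, a role inclusion $R\sqsubseteq S$, a range restriction $\mathrm{ran}(R)\sqsubseteq A$, or an assertion $A(a)$ or $R(a,b)$ (with $A\in N_C$, $R,S\in N_R$, $a,b\in N_I$). A monomial is a finite product of variables from $N_V$ (the empty product is $1$); write $m\approx n$ if the same variables occur in $m$ and $n$. An annotated ontology $\mathcal O$ is a finite set of pairs $(\alpha,v)$ of an axiom $\alpha$ and $v\in N_V\cup\{1\}$. An annotated interpretation $\mathcal I$ consists of non-empty disjoint sets $\Delta,\Delta_{\mathsf m}$ and maps each $a\in N_I$ to $a^{\mathcal I}\in\Delta$, each $A\in N_C$ to $A^{\mathcal I}\subseteq\Delta\times\Delta_{\mathsf m}$, each $R\in N_R$ to $R^{\mathcal I}\subseteq\Delta\times\Delta\times\Delta_{\mathsf m}$, and each monomial $m$ to $m^{\mathcal I}\in\Delta_{\mathsf m}$ such that $m^{\mathcal I}=n^{\mathcal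 I}$ iff $m\approx n$. It is extended by $\top^{\mathcal I}=\Delta\times\{1^{\mathcal I}\}$, $(C\sqcap D)^{\mathcal I}=\{(d,(mn)^{\mathcal I})\mid (d,m^{\mathcal I})\in C^{\mathcal I},(d,n^{\mathcal I})\in D^{\mathcal I}\}$, $(\exists R.C)^{\mathcal I}=\{(d,(mn)^{\mathcal I})\mid \exists e:(d,e,m^{\mathcal I})\in R^{\mathcal I},(e,n^{\mathcal I})\in C^{\mathcal I}\}$, $(\exists R)^{\mathcal I}=\{(d,m^{\mathcal I})\mid\exists e:(d,e,m^{\mathcal I})\in R^{\mathcal I}\}$, $(\mathrm{ran}(R))^{\mathcal I}=\{(e,m^{\mathcal I})\mid\exists d:(d,e,m^{\mathcal I})\in R^{\mathcal I}\}$. Then $\mathcal I\models(X\sqsubseteq Y,m)$, for a GCI, range restriction or role inclusion, if for all monomials $n$, $(\vec d,n^{\mathcal I})\in X^{\mathcal I}$ implies $(\vec d,(mn)^{\mathcal I})\in Y^{\mathcal I}$; $\mathcal I\models(A(a),m)$ if $(a^{\mathcal I},m^{\mathcal I})\in A^{\mathcal I}$; $\mathcal I\models(R(a,b),m)$ if $(a^{\mathcal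 I},b^{\mathcal I},m^{\mathcal I})\in R^{\mathcal I}$. Finally $\mathcal O\models(\alpha,m)$ if every $\mathcal I$ that satisfies all elements of $\mathcal O$ satisfies $(\alpha,m)$. The size $|X|$ is the length of the string representing $X$, where each name and variable has length one. **Statement.** For every axiom $\alpha$, the problem $\mathcal O\models(\alpha,m)$ is decidable in time polynomial in $|\mathcal O|$ and exponential in $|m|$. Precisely: there are a single deterministic algorithm and a constant $c$ such that, on every input consisting of an annotated ontology $\mathcal O$, an axiom $\alpha$ and a monomial $m$, the algorithm halts after at most $c\,(|\mathcal O|+|\alpha|)^{c}\,2^{c(|m|+|\alpha|)}$ steps and answers correctly whether $\mathcal O\models(\alpha,m)$. In particular, for each fixed $\alpha$ the running time is at most $K_\alpha\,|\mathcal O|^{c}\,2^{c|m|}$ for a constant $K_\alpha$. Here algorithms are WHILE programs over binary trees whose leaves are $\mathrm{nil}$ or names, with unit cost for each elementary operation (pairing, projections, tests, equality of two names). -/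

import Mathlib

namespace ELHr

/-! ### Names, monomials, axioms, annotated ontologies -/

/-- Concept names. The four countably infinite sets of names are kept apart by their positions in
the syntax. -/
abbrev ConceptName := ℕ
/-- Role names. -/
abbrev RoleName := ℕ
/-- Individual names. -/
abbrev IndName := ℕ
/-- Provenance variables. -/
abbrev Var := ℕ

/-- A monomial is a finite product of variables, as a string; the empty product is `1`, and the
product of two monomials is the concatenation `m ++ n`. -/
abbrev Monomial := List Var

/-- Two monomials are equivalent when they are equal modulo commutativity, associativity and
idempotency of the product, i.e. when the same variables occur in them. -/
def TrioEquiv (m n : Monomial) : Prop := ∀ v : Var, v ∈ m ↔ v ∈ n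

/-- Left-hand sides of GCIs: `C ::= A | ∃R.C | C ⊓ C | ⊤`. -/
inductive Concept : Type
  | top : Concept
  | name (A : ConceptName) : Concept
  | conj (C D : Concept) : Concept
  | ex (R : RoleName) (C : Concept) : Concept

/-- Right-hand sides of GCIs: `D ::= A | ∃R`. -/
inductive RhsConcept : Type
  | name (A : ConceptName) : RhsConcept
  | ex (R : RoleName) : RhsConcept

/-- Axioms of the description logic. -/
inductive DLAxiom : Type
  /-- general concept inclusion `C ⊑ D` -/
  | gci (C : Concept) (D : RhsConcept) : DLAxiom
  /-- role inclusion `R ⊑ S` -/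
  | ri (R S : RoleName) : DLAxiom
  /-- range restriction `ran(R) ⊑ A` -/
  | rr (R : RoleName) (A : ConceptName) : DLAxiom
  /-- concept assertion `A(a)` -/
  | ca (A : ConceptName) (a : IndName) : DLAxiom
  /-- role assertion `R(a,b)` -/
  | ra (R : RoleName) (a b : IndName) : DLAxiom

/-- Annotations in an ontology: a variable (`some v`) or `1` (`none`). -/
abbrev Annotation := Option Var

/-- An annotation as a monomial. -/
def annMonomial : Annotation → Monomial
  | none => []
  | some v => [v]

/-- An annotated ontology: a finite set of axioms annotated in `N_V ∪ {1}`, listed in some order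
(possibly with repetitions). -/
abbrev Ontology := List (DLAxiom × Annotation)

/-! ### Sizes: string lengths, where every name counts one -/

def Concept.size : Concept → ℕ
  | .top => 1
  | .name _ => 1
  | .conj C D => C.size + D.size + 3
  | .ex _ C => C.size + 3

def RhsConcept.size : RhsConcept → ℕ
  | .name _ => 1
  | .ex _ => 2

def DLAxiom.size : DLAxiom → ℕ
  | .gci C D => C.size + 1 + D.size
  | .ri _ _ => 3
  | .rr _ _ => 6
  | .ca _ _ => 4
  | .ra _ _ _ => 6

/-- `1` and `v` have length one, `v × u` has length three, and so on. -/
def monSize : Monomial → ℕ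
  | [] => 1
  | [_] => 1
  | _ :: u :: m => 2 + monSize (u :: m)

/-- The string `(α,v)` has length `|α| + 4`; it is followed by a comma or the closing brace. -/
def ontSize (O : Ontology) : ℕ := 1 + (O.map fun p => p.1.size + 5).sum

/-! ### Semantics -/

/-- Annotated interpretations. The two domains are disjoint, being different types. -/
structure Interp where
  /-- the domain -/
  Dom : Type
  /-- the domain of monomials -/
  MonDom : Type
  dom_nonempty : Nonempty Dom
  monDom_nonempty : Nonempty MonDom
  ind : IndName → Dom
  concept : ConceptName → Set (Dom × MonDom)
  role : RoleName → Set (Dom × Dom × MonDom)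
  mon : Monomial → MonDom
  mon_eq_iff : ∀ m n : Monomial, mon m = mon n ↔ TrioEquiv m n

namespace Interp

/-- The extension of a concept `C`. -/
def ext (I : Interp) : Concept → Set (I.Dom × I.MonDom)
  | .top => {p | p.2 = I.mon []}
  | .name A => I.concept A
  | .conj C D => {p | ∃ m n : Monomial, p.2 = I.mon (m ++ n) ∧
      (p.1, I.mon m) ∈ I.ext C ∧ (p.1, I.mon n) ∈ I.ext D}
  | .ex R C => {p | ∃ (e : I.Dom) (m n : Monomial), p.2 = I.mon (m ++ n) ∧
      (p.1, e, I.mon m) ∈ I.role R ∧ (e, I.mon n) ∈ I.ext C}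

/-- The extension of `∃R`. -/
def extEx (I : Interp) (R : RoleName) : Set (I.Dom × I.MonDom) :=
  {p | ∃ (e : I.Dom) (m : Monomial), p.2 = I.mon m ∧ (p.1, e, I.mon m) ∈ I.role R}

/-- The extension of `ran(R)`. -/
def extRan (I : Interp) (R : RoleName) : Set (I.Dom × I.MonDom) :=
  {p | ∃ (d : I.Dom) (m : Monomial), p.2 = I.mon m ∧ (d, p.1, I.mon m) ∈ I.role R}

/-- The extension of the right-hand side of a GCI. -/
def extRhs (I : Interp) : RhsConcept → Set (I.Dom × I.MonDom)
  | .name A => I.concept A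
  | .ex R => I.extEx R

/-- `I` satisfies the inclusion `X ⊑ Y`, annotated with `m`, of two concept extensions. -/
def Incl (I : Interp) (X Y : Set (I.Dom × I.MonDom)) (m : Monomial) : Prop :=
  ∀ (d : I.Dom) (n : Monomial), (d, I.mon n) ∈ X → (d, I.mon (m ++ n)) ∈ Y

/-- `I ⊨ (α, m)`. -/
def Sat (I : Interp) : DLAxiom → Monomial → Prop
  | .gci C D, m => I.Incl (I.ext C) (I.extRhs D) m
  | .ri R S, m => ∀ (d e : I.Dom) (n : Monomial),
      (d, e, I.mon n) ∈ I.role R → (d, e, I.mon (m ++ n)) ∈ I.role S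
  | .rr R A, m => I.Incl (I.extRan R) (I.concept A) m
  | .ca A a, m => (I.ind a, I.mon m) ∈ I.concept A
  | .ra R a b, m => (I.ind a, I.ind b, I.mon m) ∈ I.role R

/-- `I` is a model of `O`. -/
def IsModel (I : Interp) (O : Ontology) : Prop :=
  ∀ p ∈ O, I.Sat p.1 (annMonomial p.2)

end Interp

/-- `O ⊨ (α, m)`. -/
def Entails (O : Ontology) (α : DLAxiom) (m : Monomial) : Prop :=
  ∀ I : Interp, I.IsModel O → I.Sat α m

/-! ### Machine model

Programs work on binary trees (S-expressions) whose leaves are `nil` or atoms, as in the usual WHILE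
language over trees. Each elementary operation (taking a component, building one pair, comparing
two atoms, one test) costs one step. Trees are shared pointers, so each step takes constant time and
allocates at most one cell; no operation inspects more than the top of a tree. Atoms stand for names:
they have length one and can only be copied and compared for equality. With names written as bit
strings, this model and Turing machines simulate each other with polynomial overhead. -/

inductive Data : Type
  | nil : Data
  | atom (n : ℕ) : Data
  | cons (a b : Data) : Data

namespace Data

def hd : Data → Data
  | .cons a _ => a
  | _ => .nil

def tl : Data → Data
  | .cons _ b => b
  | _ => .nil

/-- `false` is `nil`, and `true` is the tree `(nil . nil)`. -/
def ofBool : Bool → Data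
  | false => .nil
  | true => .cons .nil .nil

/-- The test whether the two components of a pair are the same atom. -/
def sameAtom : Data → Data
  | .cons (.atom m) (.atom n) => ofBool (decide (m = n))
  | _ => .nil

def ofList : List Data → Data
  | [] => .nil
  | a :: l => .cons a (ofList l)

/-- Numbers in unary, used as tags. -/
def num : ℕ → Data
  | 0 => .nil
  | k + 1 => .cons .nil (num k)

/-- A tagged node with its arguments. -/
def node (k : ℕ) (l : List Data) : Data := .cons (num k) (ofList l)

end Data

/-- Programs; each of them transforms one tree. -/
inductive Prog : Type
  /-- return the input -/
  | skip : Prog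
  /-- return `nil` -/
  | nil : Prog
  /-- first component -/
  | hd : Prog
  /-- second component -/
  | tl : Prog
  /-- compare two atoms -/
  | sameAtom : Prog
  /-- run both programs on the input, and pair the results -/
  | pair (p q : Prog) : Prog
  /-- run `p`, then `q` on the result -/
  | seq (p q : Prog) : Prog
  /-- if `c` returns a tree other than `nil` then `p` else `q`, on the same input -/
  | ite (c p q : Prog) : Prog
  /-- while `c` returns a tree other than `nil`, replace the current tree by the result of `p` -/
  | loop (c p : Prog) : Prog

/-- `Runs p x y t`: on input `x`, the program `p` halts with output `y` after exactly `t` steps. -/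
inductive Runs : Prog → Data → Data → ℕ → Prop
  | skip (x : Data) : Runs .skip x x 1
  | nil (x : Data) : Runs .nil x .nil 1
  | hd (x : Data) : Runs .hd x x.hd 1
  | tl (x : Data) : Runs .tl x x.tl 1
  | sameAtom (x : Data) : Runs .sameAtom x x.sameAtom 1
  | pair {p q : Prog} {x y z : Data} {s t : ℕ} :
      Runs p x y s → Runs q x z t → Runs (.pair p q) x (.cons y z) (s + t + 1)
  | seq {p q : Prog} {x y z : Data} {s t : ℕ} :
      Runs p x y s → Runs q y z t → Runs (.seq p q) x z (s + t + 1)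
  | ite_true {c p q : Prog} {x y z : Data} {s t : ℕ} :
      Runs c x y s → y ≠ .nil → Runs p x z t → Runs (.ite c p q) x z (s + t + 1)
  | ite_false {c p q : Prog} {x z : Data} {s t : ℕ} :
      Runs c x .nil s → Runs q x z t → Runs (.ite c p q) x z (s + t + 1)
  | loop_done {c p : Prog} {x : Data} {s : ℕ} :
      Runs c x .nil s → Runs (.loop c p) x x (s + 1)
  | loop_step {c p : Prog} {x y z w : Data} {s t u : ℕ} :
      Runs c x y s → y ≠ .nil → Runs p x z t → Runs (.loop c p) z w u →
      Runs (.loop c p) x w (s + t + u + 1)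

/-- The machine is deterministic: output and running time are determined by program and input. -/
theorem Runs.unique {p : Prog} {x y y' : Data} {t t' : ℕ}
    (h : Runs p x y t) (h' : Runs p x y' t') : y = y' ∧ t = t' := by
  induction h generalizing y' t' with
  | skip => cases h'; exact ⟨rfl, rfl⟩
  | nil => cases h'; exact ⟨rfl, rfl⟩
  | hd => cases h'; exact ⟨rfl, rfl⟩
  | tl => cases h'; exact ⟨rfl, rfl⟩
  | sameAtom => cases h'; exact ⟨rfl, rfl⟩
  | pair _ _ ih1 ih2 =>
    cases h' with
    | pair a b =>
      obtain ⟨rfl, rfl⟩ := ih1 a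
      obtain ⟨rfl, rfl⟩ := ih2 b
      exact ⟨rfl, rfl⟩
  | seq _ _ ih1 ih2 =>
    cases h' with
    | seq a b =>
      obtain ⟨rfl, rfl⟩ := ih1 a
      obtain ⟨rfl, rfl⟩ := ih2 b
      exact ⟨rfl, rfl⟩
  | ite_true _ hy _ ih1 ih2 =>
    cases h' with
    | ite_true a _ b =>
      obtain ⟨rfl, rfl⟩ := ih1 a
      obtain ⟨rfl, rfl⟩ := ih2 b
      exact ⟨rfl, rfl⟩
    | ite_false a b => exact absurd (ih1 a).1 hy
  | ite_false _ _ ih1 ih2 =>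
    cases h' with
    | ite_true a ha b => exact absurd (ih1 a).1.symm ha
    | ite_false a b =>
      obtain ⟨-, rfl⟩ := ih1 a
      obtain ⟨rfl, rfl⟩ := ih2 b
      exact ⟨rfl, rfl⟩
  | loop_done _ ih1 =>
    cases h' with
    | loop_done a =>
      obtain ⟨-, rfl⟩ := ih1 a
      exact ⟨rfl, rfl⟩
    | loop_step a ha b d => exact absurd (ih1 a).1.symm ha
  | loop_step _ hy _ _ ih1 ih2 ih3 =>
    cases h' with
    | loop_done a => exact absurd (ih1 a).1 hy
    | loop_step a ha b d =>
      obtain ⟨rfl, rfl⟩ := ih1 a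
      obtain ⟨rfl, rfl⟩ := ih2 b
      obtain ⟨rfl, rfl⟩ := ih3 d
      exact ⟨rfl, rfl⟩

/-! ### Inputs as trees; every name becomes one atom -/

def Concept.enc : Concept → Data
  | .top => .node 0 []
  | .name A => .node 1 [.atom A]
  | .conj C D => .node 2 [C.enc, D.enc]
  | .ex R C => .node 3 [.atom R, C.enc]

def RhsConcept.enc : RhsConcept → Data
  | .name A => .node 0 [.atom A]
  | .ex R => .node 1 [.atom R]

def DLAxiom.enc : DLAxiom → Data
  | .gci C D => .node 0 [C.enc, D.enc]
  | .ri R S => .node 1 [.atom R, .atom S]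
  | .rr R A => .node 2 [.atom R, .atom A]
  | .ca A a => .node 3 [.atom A, .atom a]
  | .ra R a b => .node 4 [.atom R, .atom a, .atom b]

def monEnc (m : Monomial) : Data := .ofList (m.map .atom)

def ontEnc (O : Ontology) : Data :=
  .ofList (O.map fun p => .cons p.1.enc (monEnc (annMonomial p.2)))

/-- The input of the decision problem. -/
def inputEnc (O : Ontology) (α : DLAxiom) (m : Monomial) : Data :=
  .ofList [ontEnc O, α.enc, monEnc m]

end ELHr

/-! Modulo `TrioEquiv` a monomial is a finite set of variables, and multiplication only enlarges it.
A derivation of a fact annotated with `L` therefore uses only annotations dividing `L`. There are at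
most 2^|L| of these, each represented by a sublist of `L`.

For an assertion, `L` is the queried monomial `m`. An inclusion quantifies over all instances of its
left-hand side, so it is tested on a generic one: a fresh element for the root and for every
existential, and a fresh variable for every occurrence of a concept name or existential. Then `L` is
`m` times all fresh variables, and the inclusion is entailed iff its right-hand side is derived for
the generic instance at exactly `L`. Derivations are Horn clauses over the individuals, the fresh
elements and one anonymous witness per role name and divisor of `L`. The clauses are polynomially
many in the input and 2^|L|, and unit propagation saturates them.

Soundness: an anonymous witness stands for every successor along its role with its annotation, and
under this reading all clauses hold in every model (`holds_of_isClause`). Any actual instance of the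
left-hand side arises from the generic one by choosing values for the fresh elements and variables
(`exists_assignment`).

Completeness: the derived facts form an interpretation in which, in addition, everything holds at
monomials not dividing `L` (`canonicalModel`). A factor of a divisor of `L` divides `L`, so this
convention never affects evaluation at divisors, while it satisfies every axiom elsewhere
(`ext_mem_derived`, `sat_derivedModel`).

Running time: `Poly` is closed under the list operations of which the algorithm consists, given the
list of divisors. Only that list is exponential, and |L| ≤ |m| + |α| (`length_queryToks_le`). -/

namespace ELHr

/-! ### Sizes of trees -/

namespace Data

/-- Twice the number of leaves. -/
def size : Data → ℕ
  | nil => 2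
  | atom _ => 2
  | cons a b => a.size + b.size

/-- Leaves count double for the sake of this bound: with a base of at least 2, constants and sums
are absorbed by raising the exponent, so that single powers suffice as polynomial bounds. -/
theorem two_le_size : ∀ x : Data, 2 ≤ x.size
  | nil => le_rfl
  | atom _ => le_rfl
  | cons a _ => le_trans (two_le_size a) (Nat.le_add_right _ _)

theorem size_hd_le (x : Data) : x.hd.size ≤ x.size := by
  cases x <;> simp [hd, size]

theorem size_tl_le (x : Data) : x.tl.size ≤ x.size := by
  cases x <;> simp [tl, size]

/-- A tree all of whose leaves are `nil`. -/
def Atomless : Data → Prop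
  | nil => True
  | atom _ => False
  | cons a b => a.Atomless ∧ b.Atomless

theorem ofBool_ne_nil {b : Bool} : ofBool b ≠ nil ↔ b = true := by
  cases b <;> simp [ofBool]

theorem ofList_injective : Function.Injective ofList := by
  intro l
  induction l with
  | nil => rintro (_ | ⟨b, l'⟩) h <;> simp_all [ofList]
  | cons a l ih =>
    rintro (_ | ⟨b, l'⟩) h
    · simp [ofList] at h
    · simp only [ofList, cons.injEq] at h
      rw [h.1, ih h.2]

end Data

/-! ### Encoded types -/

/-- Types whose elements are represented by trees. -/
class Enc (α : Type) where
  enc : α → Data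
  enc_injective : Function.Injective enc

open Enc

instance : Enc Data := ⟨id, Function.injective_id⟩

instance : Enc Unit := ⟨fun _ => .nil, fun _ _ _ => rfl⟩

instance : Enc Bool := ⟨Data.ofBool, by
  intro a b h
  cases a <;> cases b <;> simp_all [Data.ofBool]⟩

/-- Numbers are used as names. -/
instance : Enc ℕ := ⟨Data.atom, fun _ _ h => Data.atom.inj h⟩

instance {α : Type} [Enc α] : Enc (List α) :=
  ⟨fun l => .ofList (l.map enc),
    Data.ofList_injective.comp (List.map_injective_iff.2 enc_injective)⟩

instance {α β : Type} [Enc α] [Enc β] : Enc (α × β) :=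
  ⟨fun p => .cons (enc p.1) (enc p.2), by
    rintro ⟨a, b⟩ ⟨c, d⟩ h
    simp only [Data.cons.injEq] at h
    rw [enc_injective h.1, enc_injective h.2]⟩

section
variable {α β γ σ : Type} [Enc α] [Enc β] [Enc γ] [Enc σ]

/-- The size of the tree representing `a`. -/
def sz (a : α) : ℕ := (enc a).size

theorem two_le_sz (a : α) : 2 ≤ sz a := Data.two_le_size _

theorem sz_pair (a : α) (b : β) : sz (a, b) = sz a + sz b := rfl

theorem sz_nil : sz ([] : List α) = 2 := rfl

theorem sz_cons (a : α) (l : List α) : sz (a :: l) = sz a + sz l := rfl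

theorem sz_append (l l' : List α) : sz (l ++ l') + 2 = sz l + sz l' := by
  induction l with
  | nil => simp [sz_nil]; ring
  | cons a l ih => simp only [List.cons_append, sz_cons]; omega

theorem sz_bool_le (b : Bool) : sz b ≤ 4 := by
  cases b <;> decide

theorem length_le_sz (l : List α) : 2 * l.length + 2 ≤ sz l := by
  induction l with
  | nil => simp [sz_nil]
  | cons a l ih => simp only [List.length_cons, sz_cons]; have := two_le_sz a; omega

theorem sz_le_of_sublist {l l' : List α} (h : l.Sublist l') : sz l ≤ sz l' := by
  induction h with
  | slnil => exact le_rfl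
  | cons a _ ih => rw [sz_cons]; omega
  | cons_cons a _ ih => rw [sz_cons, sz_cons]; omega

theorem sz_reverse (l : List α) : sz l.reverse = sz l := by
  induction l with
  | nil => rfl
  | cons a l ih =>
    have := sz_append l.reverse [a]
    rw [List.reverse_cons, sz_cons]
    simp only [sz_cons, sz_nil] at this
    omega

end

/-! ### Polynomial bounds -/

/-- `n` is bounded by a power of `s`. -/
def PolyBdd {α : Type} (s n : α → ℕ) : Prop := ∃ k, ∀ a, n a ≤ s a ^ k

namespace PolyBdd
variable {α : Type} {s n n' : α → ℕ}

theorem mono (h : PolyBdd s n) (h' : ∀ a, n' a ≤ n a) : PolyBdd s n' :=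
  h.imp fun _ hk a => (h' a).trans (hk a)

theorem self : PolyBdd s s := ⟨1, fun a => by simp⟩

theorem const (hs : ∀ a, 2 ≤ s a) (c : ℕ) : PolyBdd s fun _ => c :=
  ⟨c, fun a => (Nat.lt_two_pow_self (n := c)).le.trans (Nat.pow_le_pow_left (hs a) c)⟩

theorem mul (h : PolyBdd s n) (h' : PolyBdd s n') : PolyBdd s fun a => n a * n' a := by
  obtain ⟨k, hk⟩ := h
  obtain ⟨j, hj⟩ := h'
  exact ⟨k + j, fun a => by rw [pow_add]; exact Nat.mul_le_mul (hk a) (hj a)⟩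

theorem add (hs : ∀ a, 2 ≤ s a) (h : PolyBdd s n) (h' : PolyBdd s n') :
    PolyBdd s fun a => n a + n' a := by
  obtain ⟨k, hk⟩ := h
  obtain ⟨j, hj⟩ := h'
  refine ⟨k + j + 1, fun a => ?_⟩
  have h0 : 0 < s a := lt_of_lt_of_le (by norm_num) (hs a)
  have h1 : n a ≤ s a ^ (k + j) := (hk a).trans (Nat.pow_le_pow_right h0 (by omega))
  have h2 : n' a ≤ s a ^ (k + j) := (hj a).trans (Nat.pow_le_pow_right h0 (by omega))
  have h3 := Nat.mul_le_mul_left (s a ^ (k + j)) (hs a)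
  calc n a + n' a ≤ s a ^ (k + j) * 2 := by omega
    _ ≤ s a ^ (k + j + 1) := by rw [pow_succ]; exact h3

theorem pow (h : PolyBdd s n) (c : ℕ) : PolyBdd s fun a => n a ^ c := by
  obtain ⟨k, hk⟩ := h
  exact ⟨k * c, fun a => by rw [pow_mul]; exact Nat.pow_le_pow_left (hk a) c⟩

end PolyBdd

/-! ### Functions computed in polynomial time -/

section
variable {α β γ σ : Type} [Enc α] [Enc β] [Enc γ] [Enc σ]

/-- `f` is computed in polynomial time, and its values have polynomial size. -/
def Poly (f : α → β) : Prop :=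
  ∃ (P : Prog) (k : ℕ), ∀ a, sz (f a) ≤ sz a ^ k ∧
    ∃ t ≤ sz a ^ k, Runs P (enc a) (enc (f a)) t

theorem Poly.of_bdd {f : α → β} (P : Prog) (hs : PolyBdd sz fun a => sz (f a)) {T : α → ℕ}
    (hT : PolyBdd sz T) (h : ∀ a, ∃ t ≤ T a, Runs P (enc a) (enc (f a)) t) : Poly f := by
  obtain ⟨k, hk⟩ := hs
  obtain ⟨j, hj⟩ := hT
  refine ⟨P, k + j, fun a => ⟨?_, ?_⟩⟩
  · exact (hk a).trans (Nat.pow_le_pow_right (by have := two_le_sz a; omega) (by omega))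
  · obtain ⟨t, ht, hr⟩ := h a
    exact ⟨t, ht.trans ((hj a).trans
      (Nat.pow_le_pow_right (by have := two_le_sz a; omega) (by omega))), hr⟩

theorem Poly.bdd {f : α → β} (h : Poly f) : PolyBdd sz fun a => sz (f a) := by
  obtain ⟨P, k, h⟩ := h
  exact ⟨k, fun a => (h a).1⟩

/-- A constant number of steps, and no growth. -/
theorem Poly.of_runs {f : α → β} (P : Prog) (t : ℕ) (hs : ∀ a, sz (f a) ≤ sz a)
    (h : ∀ a, Runs P (enc a) (enc (f a)) t) : Poly f :=
  Poly.of_bdd P (PolyBdd.self.mono hs) (PolyBdd.const two_le_sz t) fun a => ⟨t, le_rfl, h a⟩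

/-- A function that acts on trees as `g` does. -/
theorem Poly.congr_enc {δ ε : Type} [Enc δ] [Enc ε] {g : δ → ε} (hg : Poly g) {f : α → β}
    (u : α → δ) (hu : ∀ a, enc (u a) = enc a) (h : ∀ a, enc (f a) = enc (g (u a))) : Poly f := by
  obtain ⟨P, k, hP⟩ := hg
  refine ⟨P, k, fun a => ?_⟩
  have := hP (u a)
  simpa only [sz, hu, ← h] using this

theorem Poly.id : Poly fun a : α => a :=
  Poly.of_runs .skip 1 (fun _ => le_rfl) fun _ => .skip _

theorem Poly.comp {g : β → γ} {f : α → β} (hg : Poly g) (hf : Poly f) :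
    Poly fun a => g (f a) := by
  obtain ⟨P, k, hP⟩ := hf
  obtain ⟨Q, j, hQ⟩ := hg
  have hb : PolyBdd (sz (α := α)) fun a => (sz a ^ k) ^ j := (PolyBdd.self.pow k).pow j
  refine Poly.of_bdd (.seq P Q) (hb.mono fun a => (hQ (f a)).1.trans
    (Nat.pow_le_pow_left (hP a).1 j)) (T := fun a => sz a ^ k + (sz a ^ k) ^ j + 1)
    ((PolyBdd.add two_le_sz (PolyBdd.add two_le_sz (PolyBdd.self.pow k) hb)
      (PolyBdd.const two_le_sz 1))) fun a => ?_
  obtain ⟨h1, t, ht, hr⟩ := hP a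
  obtain ⟨h2, u, hu, hr'⟩ := hQ (f a)
  have := hu.trans (Nat.pow_le_pow_left h1 j)
  exact ⟨t + u + 1, by omega, .seq hr hr'⟩

theorem Poly.pair {f : α → β} {g : α → γ} (hf : Poly f) (hg : Poly g) :
    Poly fun a => (f a, g a) := by
  have hs := PolyBdd.add two_le_sz hf.bdd hg.bdd
  obtain ⟨P, k, hP⟩ := hf
  obtain ⟨Q, j, hQ⟩ := hg
  refine Poly.of_bdd (.pair P Q) hs (T := fun a => sz a ^ k + sz a ^ j + 1)
    ((PolyBdd.add two_le_sz (PolyBdd.add two_le_sz (PolyBdd.self.pow k) (PolyBdd.self.pow j))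
      (PolyBdd.const two_le_sz 1))) fun a => ?_
  obtain ⟨h1, t, ht, hr⟩ := hP a
  obtain ⟨h2, u, hu, hr'⟩ := hQ a
  exact ⟨t + u + 1, by omega, .pair hr hr'⟩

theorem Poly.fst {f : α → β × γ} (hf : Poly f) : Poly fun a => (f a).1 :=
  Poly.comp (g := Prod.fst) (Poly.of_runs .hd 1 (fun _ => Nat.le_add_right _ _) fun _ => .hd _) hf

theorem Poly.snd {f : α → β × γ} (hf : Poly f) : Poly fun a => (f a).2 :=
  Poly.comp (g := Prod.snd) (Poly.of_runs .tl 1 (fun _ => Nat.le_add_left _ _) fun _ => .tl _) hf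

theorem Poly.hd {f : α → Data} (hf : Poly f) : Poly fun a => (f a).hd :=
  Poly.comp (g := Data.hd) (Poly.of_runs .hd 1 Data.size_hd_le fun x => .hd x) hf

theorem Poly.tl {f : α → Data} (hf : Poly f) : Poly fun a => (f a).tl :=
  Poly.comp (g := Data.tl) (Poly.of_runs .tl 1 Data.size_tl_le fun x => .tl x) hf

theorem Poly.cons {f : α → β} {g : α → List β} (hf : Poly f) (hg : Poly g) :
    Poly fun a => f a :: g a :=
  (hf.pair hg).congr_enc (fun a => a) (fun _ => rfl) fun _ => rfl

/-- No program creates an atom, so only trees without atoms can be written as constants. -/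
theorem exists_prog_const (d : Data) (h : d.Atomless) :
    ∃ (P : Prog) (t : ℕ), ∀ x, Runs P x d t := by
  induction d with
  | nil => exact ⟨.nil, 1, fun x => .nil x⟩
  | atom n => exact h.elim
  | cons a b iha ihb =>
    obtain ⟨P, s, hP⟩ := iha h.1
    obtain ⟨Q, t, hQ⟩ := ihb h.2
    exact ⟨.pair P Q, s + t + 1, fun x => .pair (hP x) (hQ x)⟩

theorem Poly.const (b : β) (h : (enc b).Atomless) : Poly fun _ : α => b := by
  obtain ⟨P, t, hP⟩ := exists_prog_const (enc b) h
  exact Poly.of_bdd P (PolyBdd.const two_le_sz (sz b)) (PolyBdd.const two_le_sz t)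
    fun a => ⟨t, le_rfl, hP _⟩

theorem Poly.nil : Poly fun _ : α => ([] : List β) := Poly.const _ trivial

theorem Poly.true : Poly fun _ : α => true := Poly.const _ ⟨trivial, trivial⟩

theorem Poly.false : Poly fun _ : α => false := Poly.const _ trivial

theorem Poly.singleton {f : α → β} (hf : Poly f) : Poly fun a => [f a] := hf.cons Poly.nil

/-- Branching on whether a tree is `nil`. -/
theorem Poly.ite_ne_nil {c : α → γ} {p : α → Prop} [DecidablePred p] (hc : Poly c)
    (hp : ∀ a, enc (c a) ≠ .nil ↔ p a) {f g : α → β} (hf : Poly f) (hg : Poly g) :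
    Poly fun a => if p a then f a else g a := by
  have hs := PolyBdd.add two_le_sz hf.bdd hg.bdd
  obtain ⟨C, i, hC⟩ := hc
  obtain ⟨P, k, hP⟩ := hf
  obtain ⟨Q, j, hQ⟩ := hg
  refine Poly.of_bdd (.ite C P Q) (hs.mono fun a => ?_)
    (T := fun a => sz a ^ i + (sz a ^ k + sz a ^ j) + 1)
    ((PolyBdd.add two_le_sz (PolyBdd.add two_le_sz (PolyBdd.self.pow i)
      (PolyBdd.add two_le_sz (PolyBdd.self.pow k) (PolyBdd.self.pow j)))
      (PolyBdd.const two_le_sz 1))) fun a => ?_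
  · split_ifs <;> omega
  · obtain ⟨-, r, hr, hrr⟩ := hC a
    obtain ⟨-, t, ht, htr⟩ := hP a
    obtain ⟨-, u, hu, hur⟩ := hQ a
    split_ifs with h
    · exact ⟨r + t + 1, by omega, .ite_true hrr ((hp a).2 h) htr⟩
    · have h0 : enc (c a) = .nil := by
        by_contra hne
        exact h ((hp a).1 hne)
      rw [h0] at hrr
      exact ⟨r + u + 1, by omega, .ite_false hrr hur⟩

theorem Poly.ite {c : α → Bool} (hc : Poly c) {f g : α → β} (hf : Poly f) (hg : Poly g) :
    Poly fun a => if c a then f a else g a :=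
  Poly.ite_ne_nil (p := fun a => c a = Bool.true) hc (fun _ => Data.ofBool_ne_nil) hf hg

theorem Poly.decide_of_ne_nil {c : α → γ} (hc : Poly c) {p : α → Prop} [DecidablePred p]
    (hp : ∀ a, enc (c a) ≠ .nil ↔ p a) : Poly fun a => decide (p a) := by
  have := Poly.ite_ne_nil hc hp (Poly.true (α := α)) Poly.false
  refine this.congr_enc (fun a => a) (fun _ => rfl) fun a => ?_
  by_cases h : p a <;> simp [h]

theorem Poly.and {f g : α → Bool} (hf : Poly f) (hg : Poly g) : Poly fun a => f a && g a := by
  refine (hf.ite hg Poly.false).congr_enc (fun a => a) (fun _ => rfl) fun a => ?_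
  cases f a <;> simp

theorem Poly.or {f g : α → Bool} (hf : Poly f) (hg : Poly g) : Poly fun a => f a || g a := by
  refine (hf.ite Poly.true hg).congr_enc (fun a => a) (fun _ => rfl) fun a => ?_
  cases f a <;> simp

theorem enc_ne_nil_iff (l : List α) : enc l ≠ .nil ↔ l ≠ [] := by
  cases l <;> simp [enc, Data.ofList]

/-- Recursion on a list, without recursive calls. -/
theorem Poly.listCases {l : α → List β} (hl : Poly l) {f : α → γ} (hf : Poly f)
    {g : α → β → List β → γ} (hg : Poly fun p : α × β × List β => g p.1 p.2.1 p.2.2) :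
    Poly fun a => match l a with
      | [] => f a
      | b :: m => g a b m := by
  have h2 : PolyBdd (sz (α := α)) fun a => sz a + sz (l a) :=
    PolyBdd.add two_le_sz PolyBdd.self hl.bdd
  have hfb := hf.bdd
  obtain ⟨C, i, hC⟩ := hl
  obtain ⟨P, k, hP⟩ := hf
  obtain ⟨Q, j, hQ⟩ := hg
  -- A non-empty list has the same tree as the pair of its head and its tail. Pairing the input with
  -- the list thus already yields the argument `(a, b, m)` of `Q`.
  refine Poly.of_bdd (.ite C (.seq (.pair .skip C) Q) P) (hs := ?_)
    (T := fun a => sz a ^ i + (sz a ^ k + (sz a ^ i + 3 + (sz a + sz (l a)) ^ j)) + 1) ?_ fun a => ?_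
  · refine (PolyBdd.add two_le_sz hfb (h2.pow j)).mono fun a => ?_
    have := fun b m => (hQ (a, b, m)).1
    dsimp only at this ⊢
    cases hla : l a with
    | nil => simp
    | cons b m =>
      have := this b m
      simp only [sz_pair, sz_cons] at this ⊢
      omega
  · exact PolyBdd.add two_le_sz (PolyBdd.add two_le_sz (PolyBdd.self.pow i)
      (PolyBdd.add two_le_sz (PolyBdd.self.pow k) (PolyBdd.add two_le_sz
        (PolyBdd.add two_le_sz (PolyBdd.self.pow i) (PolyBdd.const two_le_sz 3)) (h2.pow j))))
      (PolyBdd.const two_le_sz 1)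
  · obtain ⟨-, r, hr, hrr⟩ := hC a
    obtain ⟨-, t, ht, htr⟩ := hP a
    cases hla : l a with
    | nil =>
      rw [hla] at hrr
      exact ⟨r + t + 1, by omega, .ite_false hrr htr⟩
    | cons b m =>
      obtain ⟨-, u, hu, hur⟩ := hQ (a, b, m)
      rw [hla] at hrr
      simp only [sz_pair] at hu
      rw [sz_cons]
      exact ⟨r + (1 + r + 1 + u + 1) + 1, by omega,
        .ite_true hrr (by simp [enc, Data.ofList]) (.seq (.pair (.skip _) hrr) hur)⟩

/-- While loops: an invariant that bounds the sizes, and a variant. -/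
theorem Poly.exists_loop {c : σ → Bool} {f : σ → σ} (hc : Poly c) (hf : Poly f) :
    ∃ (P : Prog) (k : ℕ), ∀ (J : σ → Prop) (μ : σ → ℕ) (M : ℕ),
      (∀ s, J s → sz s ≤ M) → (∀ s, J s → c s = Bool.true → J (f s) ∧ μ (f s) < μ s) →
      ∀ s, J s → ∃ s' t, Runs P (enc s) (enc s') t ∧ J s' ∧ c s' = Bool.false ∧
        t ≤ (μ s + 1) * M ^ k := by
  obtain ⟨C, i, hC⟩ := hc
  obtain ⟨P, j, hP⟩ := hf
  -- An iteration costs at most `M ^ i + M ^ j + 1`, and two further powers of `M ≥ 2` absorb the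
  -- constants. The program and the exponent are fixed before `J`, `μ` and `M`, so `M` may later be
  -- exponential.
  refine ⟨.loop C P, i + j + 2, fun J μ M hM hJ s => ?_⟩
  induction hn : μ s using Nat.strong_induction_on generalizing s with
  | _ n ih =>
    intro hs
    have h2 : 2 ≤ M := (two_le_sz s).trans (hM s hs)
    have hi : sz s ^ i ≤ M ^ (i + j) := (Nat.pow_le_pow_left (hM s hs) i).trans
      (Nat.pow_le_pow_right (by omega) (by omega))
    have hj : sz s ^ j ≤ M ^ (i + j) := (Nat.pow_le_pow_left (hM s hs) j).trans
      (Nat.pow_le_pow_right (by omega) (by omega))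
    have h1 : 1 ≤ M ^ (i + j) := Nat.one_le_pow _ _ (by omega)
    have h4 : 4 * M ^ (i + j) ≤ M ^ (i + j + 2) := by
      rw [pow_add M (i + j) 2, mul_comm]
      exact Nat.mul_le_mul_left _ (by nlinarith)
    obtain ⟨-, r, hr, hrr⟩ := hC s
    cases hcs : c s with
    | false =>
      rw [hcs] at hrr
      refine ⟨s, r + 1, .loop_done hrr, hs, hcs, ?_⟩
      have : M ^ (i + j + 2) ≤ (n + 1) * M ^ (i + j + 2) := Nat.le_mul_of_pos_left _ (by omega)
      omega
    | true =>
      obtain ⟨h3, h5⟩ := hJ s hs hcs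
      obtain ⟨s', t, ht, h6, h7, h8⟩ := ih _ (hn ▸ h5) (f s) rfl h3
      obtain ⟨-, u, hu, hur⟩ := hP s
      rw [hcs] at hrr
      refine ⟨s', r + u + t + 1, .loop_step hrr (by simp [enc, Data.ofBool]) hur ht, h6, h7, ?_⟩
      have : (μ (f s) + 1) * M ^ (i + j + 2) ≤ n * M ^ (i + j + 2) :=
        Nat.mul_le_mul_right _ (by omega)
      rw [Nat.add_mul n 1]
      omega

/-- Folds whose intermediate values are bounded in size. -/
theorem Poly.exists_foldl {step : γ → β → α → β}
    (hs : Poly fun p : γ × β × α => step p.1 p.2.1 p.2.2) :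
    ∃ (P : Prog) (k : ℕ), ∀ (c : γ) (b : β) (l : List α) (M : ℕ),
      (∀ i, sz ((l.take i).foldl (step c) b) ≤ M) → sz l ≤ M → sz c ≤ M →
      ∃ t ≤ M ^ k, Runs P (enc (c, b, l)) (enc (l.foldl (step c) b)) t := by
  let f : γ × β × List α → γ × β × List α := fun s => match s.2.2 with
    | [] => s
    | a :: l => (s.1, step s.1 s.2.1 a, l)
  have hf : Poly f := by
    refine Poly.listCases (l := fun s : γ × β × List α => s.2.2) (f := fun s => s)
      (g := fun s a l => (s.1, step s.1 s.2.1 a, l)) Poly.id.snd.snd Poly.id ?_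
    refine Poly.id.fst.fst.pair (Poly.pair ?_ Poly.id.snd.snd)
    exact hs.comp (Poly.id.fst.fst.pair (Poly.id.fst.snd.fst.pair Poly.id.snd.fst))
  have hc : Poly fun s : γ × β × List α => decide (s.2.2 ≠ []) :=
    Poly.decide_of_ne_nil (c := fun s : γ × β × List α => s.2.2) Poly.id.snd.snd
      fun s => enc_ne_nil_iff s.2.2
  obtain ⟨P, k, hP⟩ := Poly.exists_loop hc hf
  -- The loop ends in `(c, b, [])`, from which tail and head extract the accumulator. The three
  -- components have size at most `M` each, so the loop takes at most `M * (3 * M) ^ k` steps. Since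
  -- `3 * M ≤ M ^ 3`, the exponent `3 * k` covers the power, and 4 covers the factor `M` and the
  -- four extra steps.
  refine ⟨.seq P (.seq .tl .hd), 3 * k + 4, fun c b l M hM hl hcM => ?_⟩
  have h2 : 2 ≤ M := (two_le_sz c).trans hcM
  obtain ⟨s', t, hr, ⟨h1, h3, h4, h5⟩, h6, ht⟩ := hP
    (fun s => s.1 = c ∧ s.2.2.foldl (step c) s.2.1 = l.foldl (step c) b ∧ sz s.2.2 ≤ M ∧
      ∀ i, sz ((s.2.2.take i).foldl (step c) s.2.1) ≤ M) (fun s => s.2.2.length) (3 * M)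
    (by
      rintro ⟨c', b', l'⟩ ⟨rfl, h3, h4, h5⟩
      have := h5 0
      simp only [sz_pair, List.take_zero, List.foldl_nil] at *
      omega)
    (by
      rintro ⟨c', b', l'⟩ ⟨rfl, h3, h4, h5⟩ h6
      cases l' with
      | nil => simp at h6
      | cons a l' =>
        refine ⟨⟨rfl, h3, ?_, fun i => ?_⟩, ?_⟩
        · simp only [sz_cons] at h4
          simp only [f]
          omega
        · simpa using h5 (i + 1)
        · simp [f]) (c, b, l) ⟨rfl, rfl, hl, hM⟩
  have hnil : s'.2.2 = [] := by simpa using h6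
  refine ⟨t + (1 + 1 + 1) + 1, ?_, .seq hr ?_⟩
  · have h7 := length_le_sz l
    have h8 : 3 * M ≤ M ^ 2 * M := by nlinarith
    have h9 : (3 * M) ^ k ≤ M ^ (3 * k) := by
      rw [pow_mul]; exact Nat.pow_le_pow_left (by rw [pow_succ]; exact h8) k
    have h10 : (l.length + 1) * (3 * M) ^ k ≤ M * M ^ (3 * k) :=
      Nat.mul_le_mul (by omega) h9
    have h11 : 1 ≤ M ^ (3 * k) := Nat.one_le_pow _ _ (by omega)
    have h12 : M * M ^ (3 * k) + 4 ≤ M ^ (3 * k + 4) := by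
      have h13 : M + 4 ≤ M ^ 4 := by nlinarith [Nat.pow_le_pow_left h2 3]
      rw [pow_add M (3 * k) 4]
      nlinarith
    exact (Nat.add_le_add_right ht 4).trans ((Nat.add_le_add_right h10 4).trans h12)
  · rw [hnil] at h3
    rw [← h3]
    exact .seq (.tl _) (.hd _)

end

section
variable {α β γ σ : Type} [Enc α] [Enc β] [Enc γ] [Enc σ]

/-! ### Recursion on lists -/

/-- Folds whose steps add at most a polynomial in the sizes of the parameter and the element. -/
theorem Poly.foldl {l : γ → List α} (hl : Poly l) {b : γ → β} (hb : Poly b)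
    {step : γ → β → α → β} (hs : Poly fun p : γ × β × α => step p.1 p.2.1 p.2.2)
    (hg : ∃ k, ∀ c b a, sz (step c b a) ≤ sz b + (sz c + sz a) ^ k) :
    Poly fun c => (l c).foldl (fun b a => step c b a) (b c) := by
  obtain ⟨k, hk⟩ := hg
  -- Growth by an additive term independent of the accumulator sums to a polynomial; a step that
  -- doubles the accumulator would not.
  have hsize : ∀ c (m : List α) (b : β),
      sz (m.foldl (step c) b) ≤ sz b + m.length * (sz c + sz m) ^ k := by
    intro c m
    induction m with
    | nil => intro b; simp
    | cons a m ih =>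
      intro b
      have h1 := ih (step c b a)
      have h2 := hk c b a
      have h3 : (sz c + sz a) ^ k ≤ (sz c + sz (a :: m)) ^ k :=
        Nat.pow_le_pow_left (by rw [sz_cons]; omega) k
      have h4 : m.length * (sz c + sz m) ^ k ≤ m.length * (sz c + sz (a :: m)) ^ k :=
        Nat.mul_le_mul_left _ (Nat.pow_le_pow_left (by rw [sz_cons]; omega) k)
      rw [List.foldl_cons, List.length_cons, Nat.add_mul, Nat.one_mul]
      omega
  obtain ⟨P, j, hP⟩ := Poly.exists_foldl hs
  let M : γ → ℕ := fun c => sz (b c) + sz (l c) * (sz c + sz (l c)) ^ k + sz c + sz (l c)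
  have hM : PolyBdd sz M := by
    have h1 := PolyBdd.add two_le_sz PolyBdd.self hl.bdd
    exact PolyBdd.add two_le_sz (PolyBdd.add two_le_sz (PolyBdd.add two_le_sz hb.bdd
      (hl.bdd.mul (h1.pow k))) PolyBdd.self) hl.bdd
  have hbd : ∀ c i, sz (((l c).take i).foldl (step c) (b c)) ≤ M c := by
    intro c i
    have h1 := hsize c ((l c).take i) (b c)
    have h2 : sz ((l c).take i) ≤ sz (l c) := sz_le_of_sublist (List.take_sublist i _)
    have h3 := length_le_sz ((l c).take i)
    have h4 : ((l c).take i).length * (sz c + sz ((l c).take i)) ^ k ≤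
        sz (l c) * (sz c + sz (l c)) ^ k :=
      Nat.mul_le_mul (by omega) (Nat.pow_le_pow_left (by omega) k)
    simp only [M]
    omega
  obtain ⟨Q, i, hQ⟩ := Poly.pair Poly.id (hb.pair hl)
  refine Poly.of_bdd (.seq Q P) (hM.mono fun c => ?_) (T := fun c => sz c ^ i + M c ^ j + 1)
    (PolyBdd.add two_le_sz (PolyBdd.add two_le_sz (PolyBdd.self.pow i) (hM.pow j))
      (PolyBdd.const two_le_sz 1)) fun c => ?_
  · simpa using hbd c (l c).length
  · obtain ⟨-, t, ht, hr⟩ := hQ c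
    obtain ⟨u, hu, hr'⟩ := hP c (b c) (l c) (M c) (hbd c) (by simp only [M]; omega)
      (by simp only [M]; omega)
    exact ⟨t + u + 1, by omega, .seq hr hr'⟩

theorem Poly.reverse {l : γ → List α} (hl : Poly l) : Poly fun c => (l c).reverse := by
  have := Poly.foldl hl (Poly.nil (β := α)) (step := fun _ b a => a :: b)
    (Poly.id.snd.snd.cons Poly.id.snd.fst) ⟨1, fun c b a => by rw [sz_cons, pow_one]; omega⟩
  simpa using this

theorem Poly.foldr {l : γ → List α} (hl : Poly l) {b : γ → β} (hb : Poly b)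
    {step : γ → α → β → β} (hs : Poly fun p : γ × α × β => step p.1 p.2.1 p.2.2)
    (hg : ∃ k, ∀ c a b, sz (step c a b) ≤ sz b + (sz c + sz a) ^ k) :
    Poly fun c => (l c).foldr (fun a b => step c a b) (b c) := by
  have := Poly.foldl hl.reverse hb (step := fun c b a => step c a b)
    (hs.comp (f := fun p : γ × β × α => (p.1, p.2.2, p.2.1))
      (Poly.id.fst.pair (Poly.id.snd.snd.pair Poly.id.snd.fst)))
    (hg.imp fun k hk c b a => hk c a b)
  simpa using this

theorem Poly.append {f g : γ → List α} (hf : Poly f) (hg : Poly g) :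
    Poly fun c => f c ++ g c := by
  have := Poly.foldr hf hg (step := fun _ a b => a :: b)
    (Poly.id.snd.fst.cons Poly.id.snd.snd) ⟨1, fun c a b => by rw [sz_cons, pow_one]; omega⟩
  simpa using this

theorem Poly.flatMap {l : γ → List α} (hl : Poly l) {f : γ → α → List β}
    (hf : Poly fun p : γ × α => f p.1 p.2) : Poly fun c => (l c).flatMap fun a => f c a := by
  have := Poly.foldr hl (Poly.nil (β := β)) (step := fun c a b => f c a ++ b)
    ((hf.comp (f := fun p : γ × α × List β => (p.1, p.2.1))
      (Poly.id.fst.pair Poly.id.snd.fst)).append Poly.id.snd.snd) (by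
      obtain ⟨k, hk⟩ := hf.bdd
      refine ⟨k, fun c a b => ?_⟩
      have h1 := hk (c, a)
      have h2 := sz_append (f c a) b
      rw [sz_pair] at h1
      dsimp only at h1
      omega)
  refine this.congr_enc (fun a => a) (fun _ => rfl) fun c => ?_
  congr 1
  induction l c with
  | nil => rfl
  | cons a l ih => simp [ih]

theorem Poly.map {l : γ → List α} (hl : Poly l) {f : γ → α → β}
    (hf : Poly fun p : γ × α => f p.1 p.2) : Poly fun c => (l c).map fun a => f c a := by
  refine (Poly.flatMap hl (f := fun c a => [f c a]) hf.singleton).congr_enc (fun a => a)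
    (fun _ => rfl) fun c => ?_
  rw [List.map_eq_flatMap]

theorem Poly.filter {l : γ → List α} (hl : Poly l) {f : γ → α → Bool}
    (hf : Poly fun p : γ × α => f p.1 p.2) : Poly fun c => (l c).filter fun a => f c a := by
  refine (Poly.flatMap hl (f := fun c a => if f c a then [a] else [])
    (hf.ite Poly.id.snd.singleton Poly.nil)).congr_enc (fun a => a) (fun _ => rfl) fun c => ?_
  congr 1
  induction l c with
  | nil => rfl
  | cons a l ih => rw [List.filter_cons, List.flatMap_cons, ih]; split_ifs <;> rfl

theorem Poly.not {f : γ → Bool} (hf : Poly f) : Poly fun c => !f c := by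
  refine (hf.ite Poly.false Poly.true).congr_enc (fun a => a) (fun _ => rfl) fun c => ?_
  cases f c <;> rfl

theorem Poly.any {l : γ → List α} (hl : Poly l) {f : γ → α → Bool}
    (hf : Poly fun p : γ × α => f p.1 p.2) : Poly fun c => (l c).any fun a => f c a := by
  refine (Poly.decide_of_ne_nil (Poly.filter hl hf) (p := fun c => (l c).any (f c) = Bool.true)
    fun c => ?_).congr_enc (fun a => a) (fun _ => rfl) fun c => ?_
  · rw [enc_ne_nil_iff]
    simp
  · rw [Bool.decide_eq_true]

theorem Poly.all {l : γ → List α} (hl : Poly l) {f : γ → α → Bool}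
    (hf : Poly fun p : γ × α => f p.1 p.2) : Poly fun c => (l c).all fun a => f c a := by
  refine (Poly.any (f := fun c a => !f c a) hl hf.not).not.congr_enc (fun a => a) (fun _ => rfl) fun c => ?_
  simp [List.not_any_eq_all_not]

/-! ### Traversals with a worklist -/

/-- Each pending node heads its own traversal, so a worklist is never larger than the output still
to come. -/
theorem sublist_flatMap {τ : Type} {pre : τ → List τ} (h : ∀ a, ∃ l, pre a = a :: l) (w : List τ) :
    w.Sublist (w.flatMap pre) := by
  induction w with
  | nil => simp
  | cons a w ih =>
    obtain ⟨l, hl⟩ := h a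
    rw [List.flatMap_cons, hl, List.cons_append]
    exact (ih.trans (List.sublist_append_right _ _)).cons_cons a

/-- The preorder traversal of a tree that is given by the lists of children of its nodes. -/
theorem Poly.preorder {pre ch : α → List α} (hch : Poly ch)
    (hpre : ∀ a, pre a = a :: (ch a).flatMap pre) (hsz : PolyBdd sz fun a => sz (pre a)) :
    Poly pre := by
  let f : List α × List α → List α × List α := fun s => match s.1 with
    | [] => s
    | a :: w => (ch a ++ w, a :: s.2)
  have hf : Poly f := by
    refine Poly.listCases (l := fun s : List α × List α => s.1) (f := fun s => s)
      (g := fun s a w => (ch a ++ w, a :: s.2)) Poly.id.fst Poly.id ?_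
    exact ((hch.comp Poly.id.snd.fst).append Poly.id.snd.snd).pair
      (Poly.id.snd.fst.cons Poly.id.fst.snd)
  have hc : Poly fun s : List α × List α => decide (s.1 ≠ []) :=
    Poly.decide_of_ne_nil (c := fun s : List α × List α => s.1) Poly.id.fst
      fun s => enc_ne_nil_iff s.1
  obtain ⟨P, k, hP⟩ := Poly.exists_loop hc hf
  obtain ⟨Q, i, hQ⟩ := (Poly.id (α := α)).singleton.pair (Poly.nil (β := α))
  obtain ⟨R, j, hR⟩ := (Poly.id (α := List α × List α)).snd.reverse
  have h2M : PolyBdd sz fun a : α => 2 * sz (pre a) := (PolyBdd.const two_le_sz 2).mul hsz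
  refine Poly.of_bdd (.seq Q (.seq P R)) hsz
    (T := fun a => sz a ^ i + (sz (pre a) * (2 * sz (pre a)) ^ k + (2 * sz (pre a)) ^ j + 1) + 1)
    (PolyBdd.add two_le_sz (PolyBdd.add two_le_sz (PolyBdd.self.pow i) (PolyBdd.add two_le_sz
      (PolyBdd.add two_le_sz (hsz.mul (h2M.pow k)) (h2M.pow j)) (PolyBdd.const two_le_sz 1)))
      (PolyBdd.const two_le_sz 1)) fun a => ?_
  obtain ⟨-, r, hr, hrr⟩ := hQ a
  have hJM : ∀ s : List α × List α, s.2.reverse ++ s.1.flatMap pre = pre a →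
      sz s ≤ 2 * sz (pre a) := by
    rintro ⟨w, acc⟩ h
    have h1 : sz acc ≤ sz (pre a) := by
      rw [← sz_reverse, ← h]
      exact sz_le_of_sublist (List.sublist_append_left _ _)
    have h2 : sz w ≤ sz (pre a) := by
      rw [← h]
      exact sz_le_of_sublist ((sublist_flatMap (fun a => ⟨_, hpre a⟩) w).trans
        (List.sublist_append_right _ _))
    rw [sz_pair]
    omega
  -- Invariant: the reversed output followed by the traversals of the pending nodes is the traversal
  -- of `a`. Variant: the number of nodes still to be output.
  obtain ⟨s', t, ht, h1, h2, h3⟩ := hP (fun s => s.2.reverse ++ s.1.flatMap pre = pre a)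
    (fun s => (s.1.flatMap pre).length) (2 * sz (pre a)) hJM
    (by
      rintro ⟨w, acc⟩ h hw
      cases w with
      | nil => simp at hw
      | cons b w =>
        simp only [List.flatMap_cons, f] at h ⊢
        refine ⟨?_, ?_⟩
        · rw [← h, hpre b]
          simp
        · rw [hpre b]
          simp) ([a], []) (by simp)
  obtain ⟨-, u, hu, hur⟩ := hR s'
  have hs' : s'.1 = [] := by simpa using h2
  rw [hs'] at h1
  simp only [List.flatMap_nil, List.append_nil] at h1
  refine ⟨r + (t + u + 1) + 1, ?_, .seq hrr (.seq ht ?_)⟩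
  · have h4 := hu.trans (Nat.pow_le_pow_left (hJM s' (by simp [hs', h1])) j)
    have h5 := length_le_sz (pre a)
    have h6 : ((([a], []) : List α × List α).1.flatMap pre).length + 1 ≤ sz (pre a) := by
      simp
      omega
    have := h3.trans (Nat.mul_le_mul_right _ h6)
    omega
  · rw [← h1]
    exact hur

end

/-! ### Equality of trees -/

namespace Data

def isCons : Data → Bool
  | cons _ _ => true
  | _ => false

/-- The pairs of corresponding subtrees. -/
def zipSubtrees : Data → Data → List (Data × Data)
  | cons a b, cons c d => (cons a b, cons c d) :: (zipSubtrees a c ++ zipSubtrees b d)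
  | nil, y => [(nil, y)]
  | atom n, y => [(atom n, y)]
  | cons a b, nil => [(cons a b, nil)]
  | cons a b, atom n => [(cons a b, atom n)]

def isNil : Data → Bool
  | nil => true
  | _ => false

def isAtom : Data → Bool
  | atom _ => true
  | _ => false

/-- Whether two trees have the same root. -/
def sameRoot (x y : Data) : Bool :=
  x.isCons && y.isCons || (x.isNil && y.isNil || !(sameAtom (cons x y)).isNil)

/-- The machine compares only the tops of trees and has no recursion. Equality is therefore reduced
to an elementary test on each pair in one preorder list. -/
theorem eq_iff_sameRoot (x y : Data) :
    x = y ↔ (zipSubtrees x y).all (fun p => sameRoot p.1 p.2) = true := by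
  induction x generalizing y with
  | nil => cases y <;> simp [zipSubtrees, sameRoot, isCons, isNil, sameAtom]
  | atom n =>
    cases y with
    | nil => simp [zipSubtrees, sameRoot, isCons, isNil, sameAtom]
    | atom m =>
      by_cases h : n = m <;> simp [zipSubtrees, sameRoot, isCons, isNil, sameAtom, ofBool, h]
    | cons c d => simp [zipSubtrees, sameRoot, isCons, isNil, sameAtom]
  | cons a b iha ihb =>
    cases y with
    | nil => simp [zipSubtrees, sameRoot, isCons, isNil, sameAtom]
    | atom n => simp [zipSubtrees, sameRoot, isCons, isNil, sameAtom]
    | cons c d =>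
      rw [zipSubtrees, List.all_cons, List.all_append, Bool.and_eq_true, Bool.and_eq_true,
        ← iha, ← ihb]
      simp [sameRoot, isCons]

end Data

section
variable {α β γ σ : Type} [Enc α] [Enc β] [Enc γ] [Enc σ]

theorem Poly.isNil {f : α → Data} (hf : Poly f) : Poly fun a => (f a).isNil := by
  refine (hf.decide_of_ne_nil (p := fun a => (f a).isNil = Bool.false) fun a => ?_).not.congr_enc
    (fun a => a) (fun _ => rfl) fun a => ?_
  · change f a ≠ Data.nil ↔ _
    cases f a <;> simp [Data.isNil]
  · cases (f a).isNil <;> rfl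

theorem Poly.sameAtom {f g : α → Data} (hf : Poly f) (hg : Poly g) :
    Poly fun a => !(Data.sameAtom (.cons (f a) (g a))).isNil := by
  have : Poly (Data.sameAtom) := Poly.of_bdd .sameAtom
    ((PolyBdd.const two_le_sz 4).mono fun a => ?_) (PolyBdd.const two_le_sz 1)
    fun a => ⟨1, le_rfl, .sameAtom a⟩
  · exact (this.comp ((hf.pair hg).congr_enc (f := fun a => Data.cons (f a) (g a)) (fun a => a)
      (fun _ => rfl) fun _ => rfl)).isNil.not
  · simp only [sz, enc]
    unfold Data.sameAtom
    split
    · exact sz_bool_le _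
    · decide

/-- Atoms are the only trees that pass the atom comparison with themselves. -/
theorem Poly.isAtom {f : α → Data} (hf : Poly f) : Poly fun a => (f a).isAtom := by
  refine (hf.sameAtom hf).congr_enc (fun a => a) (fun _ => rfl) fun a => ?_
  cases f a <;> simp [Data.isAtom, Data.sameAtom, Data.isNil, Data.ofBool]

theorem Poly.isCons {f : α → Data} (hf : Poly f) : Poly fun a => (f a).isCons := by
  refine (hf.isNil.or hf.isAtom).not.congr_enc (fun a => a) (fun _ => rfl) fun a => ?_
  cases f a <;> rfl

theorem Poly.zipSubtrees : Poly fun p : Data × Data => Data.zipSubtrees p.1 p.2 := by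
  refine Poly.preorder (ch := fun p : Data × Data =>
    if p.1.isCons && p.2.isCons then [(p.1.hd, p.2.hd), (p.1.tl, p.2.tl)] else []) ?_ ?_ ?_
  · exact (Poly.id.fst.isCons.and Poly.id.snd.isCons).ite
      ((Poly.id.fst.hd.pair Poly.id.snd.hd).cons (Poly.id.fst.tl.pair Poly.id.snd.tl).singleton)
      Poly.nil
  · rintro ⟨x, y⟩
    cases x <;> cases y <;> simp [Data.zipSubtrees, Data.isCons, Data.hd, Data.tl]
  -- A square is superadditive: the cross term `2 * (|a| + |c|) * (|b| + |d|)` leaves room for the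
  -- root pair.
  · refine ⟨2, ?_⟩
    rintro ⟨x, y⟩
    dsimp only
    have base : ∀ x y : Data, sz [(x, y)] ≤ sz (x, y) ^ 2 := fun x y => by
      have := two_le_sz x
      have := two_le_sz y
      rw [sz_cons, sz_nil, sz_pair]
      nlinarith
    induction x generalizing y with
    | nil => exact base _ _
    | atom n => exact base _ _
    | cons a b iha ihb =>
      cases y with
      | nil => exact base _ _
      | atom n => exact base _ _
      | cons c d =>
        have h1 := iha c
        have h2 := ihb d
        have h3 := sz_append (Data.zipSubtrees a c) (Data.zipSubtrees b d)
        rw [Data.zipSubtrees, sz_cons]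
        have e1 : sz (Data.cons a b) = sz a + sz b := rfl
        have e2 : sz (Data.cons c d) = sz c + sz d := rfl
        simp only [sz_pair, e1, e2] at *
        have := two_le_sz a
        have := two_le_sz b
        have := two_le_sz c
        have := two_le_sz d
        nlinarith

/-- Equality of elements of an encoded type. -/
noncomputable def eqb {α : Type} (a b : α) : Bool := @decide (a = b) (Classical.propDecidable _)

@[simp] theorem eqb_iff {α : Type} {a b : α} : eqb a b = true ↔ a = b := by simp [eqb]

noncomputable def memb {α : Type} (a : α) (l : List α) : Bool := l.any fun b => eqb a b

@[simp] theorem memb_iff {α : Type} {a : α} {l : List α} : memb a l = true ↔ a ∈ l := by simp [memb]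

/-- Encodings are injective, so equality in any encoded type is equality of trees. -/
theorem Poly.eqb {f g : γ → α} (hf : Poly f) (hg : Poly g) : Poly fun c => eqb (f c) (g c) := by
  have h : Poly fun p : Data × Data =>
      (Data.zipSubtrees p.1 p.2).all fun q => Data.sameRoot q.1 q.2 := by
    refine Poly.all Poly.zipSubtrees (f := fun _ q => Data.sameRoot q.1 q.2) ?_
    exact (Poly.id.snd.fst.isCons.and Poly.id.snd.snd.isCons).or
      ((Poly.id.snd.fst.isNil.and Poly.id.snd.snd.isNil).or
        (Poly.id.snd.fst.sameAtom Poly.id.snd.snd))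
  have h' : Poly fun p : α × α => ELHr.eqb p.1 p.2 := by
    refine h.congr_enc (fun p => (enc p.1, enc p.2)) (fun _ => rfl) fun p => ?_
    have : ELHr.eqb p.1 p.2 =
        (Data.zipSubtrees (enc p.1) (enc p.2)).all fun q => Data.sameRoot q.1 q.2 := by
      rw [Bool.eq_iff_iff, eqb_iff, ← Data.eq_iff_sameRoot, enc_injective.eq_iff]
    rw [this]
  exact h'.comp (hf.pair hg)

theorem Poly.memb {f : γ → α} {l : γ → List α} (hf : Poly f) (hl : Poly l) :
    Poly fun c => memb (f c) (l c) :=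
  Poly.any hl (f := fun c b => ELHr.eqb (f c) b) ((hf.comp Poly.id.fst).eqb Poly.id.snd)

end

/-! ### Concepts and axioms as encoded types -/

namespace Data

/-- Whether the tag of a node is `k`. -/
def isNum : ℕ → Data → Bool
  | 0, x => x.isNil
  | k + 1, x => !x.isNil && isNum k x.tl

@[simp] theorem isNum_num (k j : ℕ) : isNum k (num j) = decide (k = j) := by
  induction k generalizing j with
  | zero => cases j <;> simp [isNum, num, isNil]
  | succ k ih => cases j <;> simp [isNum, num, isNil, tl, ih]

end Data

theorem Concept.enc_injective : Function.Injective Concept.enc := by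
  intro C
  induction C with
  | top => intro D h; cases D <;> simp_all [Concept.enc, Data.node, Data.num, Data.ofList]
  | name A => intro D h; cases D <;> simp_all [Concept.enc, Data.node, Data.num, Data.ofList]
  | conj C C' ih ih' =>
    intro D h
    cases D with
    | conj D D' =>
      simp only [Concept.enc, Data.node, Data.ofList, Data.cons.injEq] at h
      rw [ih h.2.1, ih' h.2.2.1]
    | _ => simp [Concept.enc, Data.node, Data.num, Data.ofList] at h
  | ex R C ih =>
    intro D h
    cases D with
    | ex S D =>
      simp only [Concept.enc, Data.node, Data.ofList, Data.cons.injEq, Data.atom.injEq] at h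
      rw [h.2.1, ih h.2.2.1]
    | _ => simp [Concept.enc, Data.node, Data.num, Data.ofList] at h

theorem RhsConcept.enc_injective : Function.Injective RhsConcept.enc := by
  intro C D h
  cases C <;> cases D <;> simp_all [RhsConcept.enc, Data.node, Data.num, Data.ofList]

theorem DLAxiom.enc_injective : Function.Injective DLAxiom.enc := by
  intro a b h
  cases a <;> cases b <;> simp_all [DLAxiom.enc, Data.node, Data.num, Data.ofList,
    Concept.enc_injective.eq_iff, RhsConcept.enc_injective.eq_iff]

instance : Enc Concept := ⟨Concept.enc, Concept.enc_injective⟩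
instance : Enc RhsConcept := ⟨RhsConcept.enc, RhsConcept.enc_injective⟩
instance : Enc DLAxiom := ⟨DLAxiom.enc, DLAxiom.enc_injective⟩

/-! The arguments of a constructor, as a list with at most one element. -/

namespace Concept

def asName : Concept → List ConceptName
  | name A => [A]
  | _ => []

def asConj : Concept → List (Concept × Concept)
  | conj C D => [(C, D)]
  | _ => []

def asEx : Concept → List (RoleName × Concept)
  | ex R C => [(R, C)]
  | _ => []

end Concept

namespace RhsConcept

def asName : RhsConcept → List ConceptName
  | name A => [A]
  | _ => []

def asEx : RhsConcept → List RoleName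
  | ex R => [R]
  | _ => []

end RhsConcept

namespace DLAxiom

def asGci : DLAxiom → List (Concept × RhsConcept)
  | gci C D => [(C, D)]
  | _ => []

def asRi : DLAxiom → List (RoleName × RoleName)
  | ri R S => [(R, S)]
  | _ => []

def asRr : DLAxiom → List (RoleName × ConceptName)
  | rr R A => [(R, A)]
  | _ => []

def asCa : DLAxiom → List (ConceptName × IndName)
  | ca A a => [(A, a)]
  | _ => []

def asRa : DLAxiom → List (RoleName × IndName × IndName)
  | ra R a b => [(R, a, b)]
  | _ => []

end DLAxiom

section
variable {α β γ σ : Type} [Enc α] [Enc β] [Enc γ] [Enc σ]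

theorem Poly.isNum (k : ℕ) {f : α → Data} (hf : Poly f) : Poly fun a => (f a).isNum k := by
  induction k generalizing f with
  | zero => exact hf.isNil
  | succ k ih => exact hf.isNil.not.and (ih hf.tl)

/-- Access to the arguments of a node with a given tag. -/
theorem Poly.ofTag {τ : Type} [Enc τ] (k : ℕ) {g : Data → τ} (hg : Poly g)
    {f : α → List β} (h : ∀ a, enc (f a) = if (enc a).hd.isNum k then enc [g (enc a).tl] else .nil) :
    Poly f := by
  refine Poly.congr_enc (g := fun x : Data => if x.hd.isNum k then [g x.tl] else [])
    ((Poly.isNum k Poly.id.hd).ite (hg.comp Poly.id.tl).singleton Poly.nil)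
    (fun a => enc a) (fun _ => rfl) fun a => ?_
  rw [h]
  split_ifs <;> rfl

theorem Poly.conceptName {f : α → Concept} (hf : Poly f) : Poly fun a => (f a).asName :=
  Poly.comp (g := Concept.asName) (Poly.ofTag 1 (g := Data.hd) Poly.id.hd fun C => by
    cases C <;> simp [enc, Concept.enc, Data.node, Data.hd, Data.tl, Data.ofList,
      Concept.asName]) hf

theorem Poly.conceptConj {f : α → Concept} (hf : Poly f) : Poly fun a => (f a).asConj :=
  Poly.comp (g := Concept.asConj) (Poly.ofTag 2 (g := fun x => (x.hd, x.tl.hd))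
    (Poly.id.hd.pair Poly.id.tl.hd) fun C => by
    cases C <;> simp [enc, Concept.enc, Data.node, Data.hd, Data.tl, Data.ofList,
      Concept.asConj]) hf

theorem Poly.conceptEx {f : α → Concept} (hf : Poly f) : Poly fun a => (f a).asEx :=
  Poly.comp (g := Concept.asEx) (Poly.ofTag 3 (g := fun x => (x.hd, x.tl.hd))
    (Poly.id.hd.pair Poly.id.tl.hd) fun C => by
    cases C <;> simp [enc, Concept.enc, Data.node, Data.hd, Data.tl, Data.ofList,
      Concept.asEx]) hf

theorem Poly.rhsName {f : α → RhsConcept} (hf : Poly f) : Poly fun a => (f a).asName :=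
  Poly.comp (g := RhsConcept.asName) (Poly.ofTag 0 (g := Data.hd) Poly.id.hd fun C => by
    cases C <;> simp [enc, RhsConcept.enc, Data.node, Data.hd, Data.tl, Data.ofList,
      RhsConcept.asName]) hf

theorem Poly.rhsEx {f : α → RhsConcept} (hf : Poly f) : Poly fun a => (f a).asEx :=
  Poly.comp (g := RhsConcept.asEx) (Poly.ofTag 1 (g := Data.hd) Poly.id.hd fun C => by
    cases C <;> simp [enc, RhsConcept.enc, Data.node, Data.hd, Data.tl, Data.ofList,
      RhsConcept.asEx]) hf

theorem Poly.asGci {f : α → DLAxiom} (hf : Poly f) : Poly fun a => (f a).asGci :=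
  Poly.comp (g := DLAxiom.asGci) (Poly.ofTag 0 (g := fun x => (x.hd, x.tl.hd))
    (Poly.id.hd.pair Poly.id.tl.hd) fun C => by
    cases C <;> simp [enc, DLAxiom.enc, Data.node, Data.hd, Data.tl, Data.ofList,
      DLAxiom.asGci]) hf

theorem Poly.asRi {f : α → DLAxiom} (hf : Poly f) : Poly fun a => (f a).asRi :=
  Poly.comp (g := DLAxiom.asRi) (Poly.ofTag 1 (g := fun x => (x.hd, x.tl.hd))
    (Poly.id.hd.pair Poly.id.tl.hd) fun C => by
    cases C <;> simp [enc, DLAxiom.enc, Data.node, Data.hd, Data.tl, Data.ofList,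
      DLAxiom.asRi]) hf

theorem Poly.asRr {f : α → DLAxiom} (hf : Poly f) : Poly fun a => (f a).asRr :=
  Poly.comp (g := DLAxiom.asRr) (Poly.ofTag 2 (g := fun x => (x.hd, x.tl.hd))
    (Poly.id.hd.pair Poly.id.tl.hd) fun C => by
    cases C <;> simp [enc, DLAxiom.enc, Data.node, Data.hd, Data.tl, Data.ofList,
      DLAxiom.asRr]) hf

theorem Poly.asCa {f : α → DLAxiom} (hf : Poly f) : Poly fun a => (f a).asCa :=
  Poly.comp (g := DLAxiom.asCa) (Poly.ofTag 3 (g := fun x => (x.hd, x.tl.hd))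
    (Poly.id.hd.pair Poly.id.tl.hd) fun C => by
    cases C <;> simp [enc, DLAxiom.enc, Data.node, Data.hd, Data.tl, Data.ofList,
      DLAxiom.asCa]) hf

theorem Poly.asRa {f : α → DLAxiom} (hf : Poly f) : Poly fun a => (f a).asRa :=
  Poly.comp (g := DLAxiom.asRa) (Poly.ofTag 4 (g := fun x => (x.hd, x.tl.hd, x.tl.tl.hd))
    (Poly.id.hd.pair (Poly.id.tl.hd.pair Poly.id.tl.tl.hd)) fun C => by
    cases C <;> simp [enc, DLAxiom.enc, Data.node, Data.hd, Data.tl, Data.ofList,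
      DLAxiom.asRa]) hf

end

-- Case distinctions on constructors are written as `map` and `flatMap` over lists of at most one
-- element. The algorithm is then a composition of these operations, and its polynomial time follows
-- from its shape.
attribute [fun_prop] Poly Poly.id Poly.comp Poly.pair Poly.fst Poly.snd Poly.cons Poly.nil
  Poly.append Poly.reverse Poly.flatMap Poly.map Poly.filter Poly.any Poly.all Poly.memb Poly.eqb
  Poly.ite Poly.conceptName Poly.conceptConj Poly.conceptEx Poly.rhsName Poly.rhsEx Poly.asGci
  Poly.asRi Poly.asRr Poly.asCa Poly.asRa

/-! ### Tokens, elements and facts of the saturation -/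

/-- Variables of the saturation: provenance variables, and a fresh one for every position of the
queried concept. -/
inductive Tok : Type
  | var (v : Var) : Tok
  | fresh (p : List Bool) : Tok

/-- Elements of the saturation: individuals, a witness for every role name and monomial, and one
element for every position of the queried concept. -/
inductive Elem : Type
  | ind (a : IndName) : Elem
  | anon (R : RoleName) (b : List Tok) : Elem
  | fresh (p : List Bool) : Elem

inductive Fact : Type
  | ext (C : Concept) (x : Elem) (b : List Tok) : Fact
  | role (R : RoleName) (x y : Elem) (b : List Tok) : Fact

/-- No tag is needed: a variable is an atom, whereas a position is a list and never an atom. -/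
instance : Enc Tok where
  enc
    | .var v => enc v
    | .fresh p => enc p
  enc_injective := by
    rintro (v | p) (w | q) h
    · rw [enc_injective h]
    · cases q <;> simp [enc, Data.ofList] at h
    · cases p <;> simp [enc, Data.ofList] at h
    · rw [enc_injective h]

/-- Again untagged: an individual is an atom, a witness is a pair whose head is an atom, and a
position is `nil` or a pair whose head encodes a Boolean. -/
instance : Enc Elem where
  enc
    | .ind a => enc a
    | .anon R b => enc (R, b)
    | .fresh p => enc p
  enc_injective := by
    have h0 (b : Bool) (n : ℕ) : Data.ofBool b ≠ .atom n := by cases b <;> simp [Data.ofBool]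
    rintro (v | ⟨R, b⟩ | p) (w | ⟨S, c⟩ | q) h
    · rw [enc_injective h]
    · simp [enc] at h
    · cases q <;> simp [enc, Data.ofList] at h
    · simp [enc] at h
    · obtain ⟨rfl, rfl⟩ := Prod.mk.inj (enc_injective h)
      rfl
    · cases q <;> simp [enc, Data.ofList] at h
      exact (h0 _ _ h.1.symm).elim
    · cases p <;> simp [enc, Data.ofList] at h
    · cases p <;> simp [enc, Data.ofList] at h
      exact (h0 _ _ h.1).elim
    · rw [enc_injective h]

instance : Enc Fact where
  enc
    | .ext C x b => enc (false, C, x, b)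
    | .role R x y b => enc (true, R, x, y, b)
  enc_injective := by
    rintro (⟨C, x, b⟩ | ⟨R, x, y, b⟩) (⟨D, u, c⟩ | ⟨S, u, v, c⟩) h
    · simp only [enc_injective.eq_iff, Prod.mk.injEq, true_and] at h
      rw [h.1, h.2.1, h.2.2]
    · simp [enc, Data.ofBool] at h
    · simp [enc, Data.ofBool] at h
    · simp only [enc_injective.eq_iff, Prod.mk.injEq, true_and] at h
      rw [h.1, h.2.1, h.2.2.1, h.2.2.2]

section
variable {α β γ : Type} [Enc α] [Enc β] [Enc γ]

@[fun_prop] theorem Poly.tokVar {f : α → ℕ} (hf : Poly f) : Poly fun a => Tok.var (f a) :=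
  hf.congr_enc (fun a => a) (fun _ => rfl) fun _ => rfl

@[fun_prop] theorem Poly.tokFresh {f : α → List Bool} (hf : Poly f) :
    Poly fun a => Tok.fresh (f a) :=
  hf.congr_enc (fun a => a) (fun _ => rfl) fun _ => rfl

@[fun_prop] theorem Poly.elemInd {f : α → ℕ} (hf : Poly f) : Poly fun a => Elem.ind (f a) :=
  hf.congr_enc (fun a => a) (fun _ => rfl) fun _ => rfl

@[fun_prop] theorem Poly.elemAnon {f : α → ℕ} (hf : Poly f) {g : α → List Tok} (hg : Poly g) :
    Poly fun a => Elem.anon (f a) (g a) :=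
  (hf.pair hg).congr_enc (fun a => a) (fun _ => rfl) fun _ => rfl

@[fun_prop] theorem Poly.elemFresh {f : α → List Bool} (hf : Poly f) :
    Poly fun a => Elem.fresh (f a) :=
  hf.congr_enc (fun a => a) (fun _ => rfl) fun _ => rfl

@[fun_prop] theorem Poly.factExt {f : α → Concept} (hf : Poly f) {g : α → Elem} (hg : Poly g)
    {h : α → List Tok} (hh : Poly h) : Poly fun a => Fact.ext (f a) (g a) (h a) :=
  (Poly.false.pair (hf.pair (hg.pair hh))).congr_enc (fun a => a) (fun _ => rfl) fun _ => rfl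

@[fun_prop] theorem Poly.factRole {f : α → ℕ} (hf : Poly f) {g g' : α → Elem} (hg : Poly g)
    (hg' : Poly g') {h : α → List Tok} (hh : Poly h) :
    Poly fun a => Fact.role (f a) (g a) (g' a) (h a) :=
  (Poly.true.pair (hf.pair (hg.pair (hg'.pair hh)))).congr_enc (fun a => a) (fun _ => rfl)
    fun _ => rfl

@[fun_prop] theorem Poly.name {f : α → ℕ} (hf : Poly f) : Poly fun a => Concept.name (f a) :=
  ((Poly.const (Data.num 1) ⟨trivial, trivial⟩).pair hf.singleton).congr_enc (fun a => a)
    (fun _ => rfl) fun _ => rfl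

@[fun_prop] theorem Poly.exTop {f : α → ℕ} (hf : Poly f) :
    Poly fun a => Concept.ex (f a) .top :=
  ((Poly.const (Data.num 3) ⟨trivial, trivial, trivial, trivial⟩).pair
    (hf.pair (Poly.const [Concept.top] ⟨⟨trivial, trivial⟩, trivial⟩))).congr_enc (fun a => a)
    (fun _ => rfl) fun _ => rfl

@[fun_prop] theorem Poly.top : Poly fun _ : α => Concept.top :=
  Poly.const _ ⟨trivial, trivial⟩

@[fun_prop] theorem Poly.consTrue {f : α → List Bool} (hf : Poly f) :
    Poly fun a => Bool.true :: f a := Poly.true.cons hf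

@[fun_prop] theorem Poly.consFalse {f : α → List Bool} (hf : Poly f) :
    Poly fun a => Bool.false :: f a := Poly.false.cons hf

end

/-! ### Positions of a concept -/

/-- The subconcept occurrences of `C`: their position, the position of the element at which they
are evaluated, and the subconcept. The occurrence `C` itself has position `p` and element `e`. -/
def positions : Concept → List Bool → List Bool → List (List Bool × List Bool × Concept)
  | .top, p, e => [(p, e, .top)]
  | .name A, p, e => [(p, e, .name A)]
  | .conj C D, p, e =>
    (p, e, .conj C D) :: (positions C (false :: p) e ++ positions D (true :: p) e)
  | .ex R C, p, e => (p, e, .ex R C) :: positions C (false :: p) (false :: p)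

/-- The bound is quadratic: linearly many occurrences, each carrying two positions and a subconcept
of linear size. The constant 4 is the largest encoding of a Boolean. The maximum is there because
the second position is either inherited or replaced by an extension of `p`. -/
theorem sz_positions_le (C : Concept) (p e : List Bool) :
    sz (positions C p e) ≤ 2 * sz C * (sz p + max (sz p) (sz e) + 4 * sz C) := by
  have ht (p : List Bool) : sz (true :: p) = 4 + sz p := rfl
  have hf (p : List Bool) : sz (false :: p) = 2 + sz p := rfl
  have hX (p e p' e' : List Bool) (c c' : ℕ) (hp : sz p' ≤ sz p + 4)
      (he : sz e' ≤ max (sz p) (sz e) + 4) (hc : c' + 2 ≤ c) :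
      2 * c' * (sz p' + max (sz p') (sz e') + 4 * c') ≤
        2 * c' * (sz p + max (sz p) (sz e) + 4 * c) := by
    refine Nat.mul_le_mul_left _ ?_
    have := le_max_left (sz p) (sz e)
    have : max (sz p') (sz e') ≤ max (sz p) (sz e) + 4 := max_le (by omega) he
    omega
  have base (C : Concept) (p e : List Bool) :
      sz [(p, e, C)] ≤ 2 * sz C * (sz p + max (sz p) (sz e) + 4 * sz C) := by
    have h1 := two_le_sz C
    have h2 := le_max_right (sz p) (sz e)
    rw [sz_cons, sz_nil, sz_pair, sz_pair]
    nlinarith [two_le_sz p, two_le_sz e]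
  induction C generalizing p e with
  | top => exact base _ _ _
  | name A => exact base _ _ _
  | conj C D ihC ihD =>
    have hc : sz (Concept.conj C D) = 6 + (sz C + (sz D + 2)) := rfl
    have h1 := (ihC (false :: p) e).trans (hX p e _ _ (sz (Concept.conj C D)) (sz C)
      (by rw [hf]; omega) (by omega) (by omega))
    have h2 := (ihD (true :: p) e).trans (hX p e _ _ (sz (Concept.conj C D)) (sz D)
      (by rw [ht]; omega) (by omega) (by omega))
    have h3 := sz_append (ELHr.positions C (false :: p) e) (ELHr.positions D (true :: p) e)
    have h4 := le_max_right (sz p) (sz e)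
    rw [ELHr.positions, sz_cons, sz_pair, sz_pair]
    generalize hY : sz p + max (sz p) (sz e) + 4 * sz (Concept.conj C D) = Y at *
    have h5 : 2 * sz (Concept.conj C D) * Y = 2 * sz C * Y + 2 * sz D * Y + 16 * Y := by
      rw [hc]; ring
    omega
  | ex R C ih =>
    have hc : sz (Concept.ex R C) = 8 + (2 + (sz C + 2)) := rfl
    have h1 := (ih (false :: p) (false :: p)).trans (hX p e _ _ (sz (Concept.ex R C)) (sz C)
      (by rw [hf]; omega) (by rw [hf]; omega) (by omega))
    have h4 := le_max_right (sz p) (sz e)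
    rw [ELHr.positions, sz_cons, sz_pair, sz_pair]
    generalize hY : sz p + max (sz p) (sz e) + 4 * sz (Concept.ex R C) = Y at *
    have h5 : 2 * sz (Concept.ex R C) * Y = 2 * sz C * Y + 24 * Y := by
      rw [hc]; ring
    omega

@[fun_prop] theorem Poly.positions {α : Type} [Enc α] {f : α → Concept} (hf : Poly f)
    {g h : α → List Bool} (hg : Poly g) (hh : Poly h) :
    Poly fun a => positions (f a) (g a) (h a) := by
  have : Poly fun i : List Bool × List Bool × Concept => ELHr.positions i.2.2 i.1 i.2.1 := by
    refine Poly.preorder (ch := fun i =>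
      (i.2.2.asConj.flatMap fun q => [(Bool.false :: i.1, i.2.1, q.1), (Bool.true :: i.1, i.2.1, q.2)]) ++
      i.2.2.asEx.map fun q => (Bool.false :: i.1, Bool.false :: i.1, q.2)) (by fun_prop) ?_ ?_
    · rintro ⟨p, e, C⟩
      cases C <;> simp [ELHr.positions, Concept.asConj, Concept.asEx]
    · have h1 := PolyBdd.self (s := sz (α := List Bool × List Bool × Concept))
      refine (((PolyBdd.const two_le_sz 8).mul (h1.mul h1))).mono fun i => ?_
      refine (sz_positions_le _ _ _).trans ?_
      obtain ⟨p, e, C⟩ := i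
      simp only [sz_pair]
      have := le_max_left (sz p) (sz e)
      have := max_le_add_of_nonneg (Nat.zero_le (sz p)) (Nat.zero_le (sz e))
      nlinarith
  exact this.comp (hg.pair (hh.pair hf))

/-! ### Saturation under Horn clauses -/

abbrev Clause : Type := List Fact × Fact

/-- One round of unit propagation. -/
noncomputable def propagate (cls : List Clause) (S : List Fact) : List Fact :=
  cls.foldl (fun S cl => if cl.1.all fun f => memb f S then cl.2 :: S else S) S

/-- The facts that follow from a list of clauses. -/
noncomputable def saturate (cls : List Clause) : List Fact :=
  cls.foldl (fun S _ => propagate cls S) []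

/-- Heads are added even when already present, but each clause fires at most once per round. -/
theorem sz_propagate_le (cls : List Clause) (S : List Fact) :
    sz (propagate cls S) ≤ sz S + sz cls := by
  induction cls generalizing S with
  | nil => exact Nat.le_add_right _ _
  | cons cl cls ih =>
    refine (ih _).trans ?_
    rw [sz_cons]
    have : sz cl = sz cl.1 + sz cl.2 := rfl
    dsimp only
    split_ifs
    · rw [sz_cons]; omega
    · omega

@[fun_prop] theorem Poly.propagate {α : Type} [Enc α] {f : α → List Clause} (hf : Poly f)
    {g : α → List Fact} (hg : Poly g) : Poly fun a => propagate (f a) (g a) := by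
  refine Poly.foldl hf hg (step := fun _ S cl => if cl.1.all fun f => ELHr.memb f S then
    cl.2 :: S else S) (by fun_prop) ⟨1, fun c S cl => ?_⟩
  have : sz cl = sz cl.1 + sz cl.2 := rfl
  split_ifs
  · rw [sz_cons, pow_one]; omega
  · omega

@[fun_prop] theorem Poly.saturate {α : Type} [Enc α] {f : α → List Clause} (hf : Poly f) :
    Poly fun a => saturate (f a) := by
  have : Poly fun cls : List Clause => ELHr.saturate cls :=
    Poly.foldl Poly.id Poly.nil (step := fun cls S _ => ELHr.propagate cls S) (by fun_prop)
      ⟨1, fun cls S _ => by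
        have := sz_propagate_le cls S
        rw [pow_one]
        omega⟩
  exact this.comp hf

/-! ### The clauses of the saturation -/

/-- The representative of a monomial among the lists that are sublists of `L`. -/
noncomputable def norm (L n : List Tok) : List Tok := L.filter fun t => memb t n

/-- The product of the annotation `n` and `b`, if it divides `L`. -/
noncomputable def annotate (L : List Tok) (n : Monomial) (b : List Tok) : List (List Tok) :=
  if (n.map Tok.var).all fun t => memb t L then [norm L (n.map Tok.var ++ b)] else []

/-- Evaluates compound concepts bottom-up. It is applied only to subconcepts of left-hand sides in
the ontology, which keeps the clauses polynomially many. -/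
noncomputable def conceptClauses (L : List Tok) (B : List (List Tok)) (E : List Elem)
    (Z : Concept) : List Clause :=
  (Z.asConj.flatMap fun q => E.flatMap fun x => B.flatMap fun b => B.map fun b' =>
    ([.ext q.1 x b, .ext q.2 x b'], .ext Z x (norm L (b ++ b')))) ++
  Z.asEx.flatMap fun q => E.flatMap fun x => E.flatMap fun y => B.flatMap fun b => B.map fun b' =>
    ([.role q.1 x y b, .ext q.2 y b'], .ext Z x (norm L (b ++ b')))

/-- The witness for `∃R` depends on the role and the resulting annotation but not on `x`, which
keeps the set of elements finite and small. Sharing it is sound because facts about it are claims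
about all successors along `R` with that annotation. -/
noncomputable def axiomClauses (L : List Tok) (B : List (List Tok)) (E : List Elem)
    (p : DLAxiom × Monomial) : List Clause :=
  (p.1.asGci.flatMap fun q => E.flatMap fun x => B.flatMap fun b =>
    (annotate L p.2 b).flatMap fun b' =>
      (q.2.asName.map fun A => ([.ext q.1 x b], .ext (.name A) x b')) ++
      q.2.asEx.map fun R => ([.ext q.1 x b], .role R x (.anon R b') b')) ++
  ((p.1.asRi.flatMap fun q => E.flatMap fun x => E.flatMap fun y => B.flatMap fun b =>
    (annotate L p.2 b).map fun b' => ([.role q.1 x y b], .role q.2 x y b')) ++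
  ((p.1.asRr.flatMap fun q => E.flatMap fun x => E.flatMap fun y => B.flatMap fun b =>
    (annotate L p.2 b).map fun b' => ([.role q.1 x y b], .ext (.name q.2) y b')) ++
  ((p.1.asCa.flatMap fun q =>
    (annotate L p.2 []).map fun b' => ([], .ext (.name q.1) (.ind q.2) b')) ++
  p.1.asRa.flatMap fun q =>
    (annotate L p.2 []).map fun b' => ([], .role q.1 (.ind q.2.1) (.ind q.2.2) b'))))

/-- The facts that hold in the universal instance of the queried concept. -/
noncomputable def itemClauses (L : List Tok) (i : List Bool × List Bool × Concept) :
    List Clause :=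
  (i.2.2.asName.map fun A => ([], .ext (.name A) (.fresh i.2.1) (norm L [.fresh i.1]))) ++
  i.2.2.asEx.map fun q =>
    ([], .role q.1 (.fresh i.2.1) (.fresh (false :: i.1)) (norm L [.fresh i.1]))

/-- A concept whose universal instance is queried. -/
def queryConcepts (α : DLAxiom) : List Concept :=
  (α.asGci.map fun q => q.1) ++
    ((α.asRi.map fun q => .ex q.1 .top) ++ α.asRr.map fun q => .ex q.1 .top)

def queryItems (α : DLAxiom) : List (List Bool × List Bool × Concept) :=
  (queryConcepts α).flatMap fun C => positions C [] []

/-- Only names and existentials contribute an annotation of their own: that of `⊤` is 1, and that of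
a conjunction is the product of its parts. -/
def itemToks (i : List Bool × List Bool × Concept) : List Tok :=
  (i.2.2.asName.map fun _ => .fresh i.1) ++ i.2.2.asEx.map fun _ => .fresh i.1

/-- The variables of the queried monomial. -/
def queryToks (α : DLAxiom) (m : Monomial) : List Tok :=
  m.map Tok.var ++ (queryItems α).flatMap fun i => itemToks i

/-- The individuals of an axiom. -/
def axiomInds (α : DLAxiom) : List IndName :=
  (α.asCa.map fun q => q.2) ++ α.asRa.flatMap fun q => [q.2.1, q.2.2]

/-- The role names that need witnesses. -/
def axiomRoles (α : DLAxiom) : List RoleName := α.asGci.flatMap fun q => q.2.asEx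

/-- The element `.fresh []` is always included, so the domain of the canonical model is non-empty
even for an assertion query. -/
def elems (O : List (DLAxiom × Monomial)) (α : DLAxiom) (B : List (List Tok)) : List Elem :=
  (((O.flatMap fun p => axiomInds p.1) ++ axiomInds α).map fun a => .ind a) ++
  (((O.flatMap fun p => axiomRoles p.1).flatMap fun R => B.map fun b => .anon R b) ++
  (.fresh [] :: (queryItems α).map fun i => .fresh i.2.1))

noncomputable def clauses (O : List (DLAxiom × Monomial)) (α : DLAxiom) (L : List Tok)
    (B : List (List Tok)) (E : List Elem) : List Clause :=
  (E.map fun x => ([], .ext .top x [])) ++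
  (((O.flatMap fun p => p.1.asGci.flatMap fun q => (positions q.1 [] []).flatMap fun i =>
    conceptClauses L B E i.2.2)) ++
  ((O.flatMap fun p => axiomClauses L B E p) ++
  (queryItems α).flatMap fun i => itemClauses L i))

/-- The facts of which one is to be derived. -/
def goals (α : DLAxiom) (L : List Tok) (E : List Elem) : List Fact :=
  (α.asGci.flatMap fun q => (q.2.asName.map fun A => .ext (.name A) (.fresh []) L) ++
    -- An unqualified existential does not name the successor, so every element is an admissible
    -- target.
    q.2.asEx.flatMap fun R => E.map fun y => .role R (.fresh []) y L) ++
  ((α.asRi.map fun q => .role q.2 (.fresh []) (.fresh [false]) L) ++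
  ((α.asRr.map fun q => .ext (.name q.2) (.fresh [false]) L) ++
  ((α.asCa.map fun q => .ext (.name q.1) (.ind q.2) L) ++
  α.asRa.map fun q => .role q.1 (.ind q.2.1) (.ind q.2.2) L)))

/-- The decision, given the variables `L` and the list `B` of the sublists of `L`. -/
noncomputable def decideEntails (O : List (DLAxiom × Monomial)) (α : DLAxiom) (L : List Tok)
    (B : List (List Tok)) : Bool :=
  (goals α L (elems O α B)).any fun f => memb f (saturate (clauses O α L B (elems O α B)))

section
variable {α : Type} [Enc α]

@[fun_prop] theorem Poly.norm {f g : α → List Tok} (hf : Poly f) (hg : Poly g) :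
    Poly fun a => norm (f a) (g a) := by
  unfold ELHr.norm
  fun_prop

@[fun_prop] theorem Poly.annotate {f g : α → List Tok} (hf : Poly f) (hg : Poly g)
    {h : α → Monomial} (hh : Poly h) : Poly fun a => annotate (f a) (h a) (g a) := by
  unfold ELHr.annotate
  fun_prop

@[fun_prop] theorem Poly.conceptClauses {l : α → List Tok} (hl : Poly l)
    {b : α → List (List Tok)} (hb : Poly b) {e : α → List Elem} (he : Poly e)
    {z : α → Concept} (hz : Poly z) :
    Poly fun a => conceptClauses (l a) (b a) (e a) (z a) := by
  unfold ELHr.conceptClauses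
  fun_prop

@[fun_prop] theorem Poly.axiomClauses {l : α → List Tok} (hl : Poly l)
    {b : α → List (List Tok)} (hb : Poly b) {e : α → List Elem} (he : Poly e)
    {z : α → DLAxiom × Monomial} (hz : Poly z) :
    Poly fun a => axiomClauses (l a) (b a) (e a) (z a) := by
  unfold ELHr.axiomClauses
  fun_prop

@[fun_prop] theorem Poly.itemClauses {l : α → List Tok} (hl : Poly l)
    {i : α → List Bool × List Bool × Concept} (hi : Poly i) :
    Poly fun a => itemClauses (l a) (i a) := by
  unfold ELHr.itemClauses
  fun_prop

@[fun_prop] theorem Poly.queryItems {f : α → DLAxiom} (hf : Poly f) :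
    Poly fun a => queryItems (f a) := by
  unfold ELHr.queryItems queryConcepts
  fun_prop

theorem Poly.queryToks {f : α → DLAxiom} (hf : Poly f) {m : α → Monomial} (hm : Poly m) :
    Poly fun a => queryToks (f a) (m a) := by
  unfold ELHr.queryToks itemToks
  fun_prop

@[fun_prop] theorem Poly.elems {o : α → List (DLAxiom × Monomial)} (ho : Poly o)
    {f : α → DLAxiom} (hf : Poly f) {b : α → List (List Tok)} (hb : Poly b) :
    Poly fun a => elems (o a) (f a) (b a) := by
  unfold ELHr.elems axiomInds axiomRoles
  fun_prop

@[fun_prop] theorem Poly.clauses {o : α → List (DLAxiom × Monomial)} (ho : Poly o)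
    {f : α → DLAxiom} (hf : Poly f) {l : α → List Tok} (hl : Poly l)
    {b : α → List (List Tok)} (hb : Poly b) {e : α → List Elem} (he : Poly e) :
    Poly fun a => clauses (o a) (f a) (l a) (b a) (e a) := by
  unfold ELHr.clauses
  fun_prop

@[fun_prop] theorem Poly.goals {f : α → DLAxiom} (hf : Poly f) {l : α → List Tok} (hl : Poly l)
    {e : α → List Elem} (he : Poly e) : Poly fun a => goals (f a) (l a) (e a) := by
  unfold ELHr.goals
  fun_prop

/-- The list of sublists is an argument here, so the exponential factor enters only through its
size. -/
theorem Poly.decideEntails {o : α → List (DLAxiom × Monomial)} (ho : Poly o)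
    {f : α → DLAxiom} (hf : Poly f) {l : α → List Tok} (hl : Poly l)
    {b : α → List (List Tok)} (hb : Poly b) :
    Poly fun a => decideEntails (o a) (f a) (l a) (b a) := by
  unfold ELHr.decideEntails
  fun_prop

end

/-! ### Correctness of unit propagation -/

theorem mem_propagate_of_mem {cls : List Clause} {S : List Fact} {f : Fact} (h : f ∈ S) :
    f ∈ propagate cls S := by
  induction cls generalizing S with
  | nil => exact h
  | cons cl cls ih =>
    refine ih ?_
    dsimp only
    split_ifs
    · exact List.mem_cons_of_mem _ h
    · exact h

theorem mem_propagate {cls : List Clause} {S : List Fact} {cl : Clause} (hcl : cl ∈ cls)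
    (h : ∀ f ∈ cl.1, f ∈ S) : cl.2 ∈ propagate cls S := by
  induction cls generalizing S with
  | nil => simp at hcl
  | cons cl' cls ih =>
    rcases List.mem_cons.1 hcl with rfl | hcl
    · refine mem_propagate_of_mem (cls := cls) ?_
      have : (cl.1.all fun f => memb f S) = true := by simpa using h
      dsimp only
      rw [if_pos this]
      exact List.mem_cons_self
    · refine ih hcl fun f hf => ?_
      dsimp only
      split_ifs
      · exact List.mem_cons_of_mem _ (h f hf)
      · exact h f hf

theorem propagate_induction {cls : List Clause} {H : Fact → Prop}
    (h : ∀ cl ∈ cls, (∀ f ∈ cl.1, H f) → H cl.2) {S : List Fact} (hS : ∀ f ∈ S, H f) :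
    ∀ f ∈ propagate cls S, H f := by
  induction cls generalizing S with
  | nil => exact hS
  | cons cl cls ih =>
    refine ih (fun c hc => h c (List.mem_cons_of_mem _ hc)) fun f hf => ?_
    dsimp only at hf
    split_ifs at hf with hall
    · rcases List.mem_cons.1 hf with rfl | hf
      · refine h cl List.mem_cons_self fun f hf => hS f ?_
        have : ∀ f ∈ cl.1, f ∈ S := by simpa using hall
        exact this f hf
      · exact hS f hf
    · exact hS f hf

theorem saturate_induction {cls : List Clause} {H : Fact → Prop}
    (h : ∀ cl ∈ cls, (∀ f ∈ cl.1, H f) → H cl.2) : ∀ f ∈ saturate cls, H f := by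
  have (l : List Clause) (S : List Fact) (hS : ∀ f ∈ S, H f) :
      ∀ f ∈ l.foldl (fun S _ => propagate cls S) S, H f := by
    induction l generalizing S with
    | nil => exact hS
    | cons _ l ih => exact ih _ (propagate_induction h hS)
  exact this cls [] (by simp)

/-- `S` is closed under the clauses. -/
def ClosedUnder (cls : List Clause) (S : List Fact) : Prop :=
  ∀ cl ∈ cls, (∀ f ∈ cl.1, f ∈ S) → cl.2 ∈ S

/-- On a closed list a round adds only facts already present, so closedness persists through the
remaining rounds. -/
theorem ClosedUnder.propagate {cls : List Clause} {S : List Fact} (h : ClosedUnder cls S) :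
    ClosedUnder cls (propagate cls S) := fun cl hcl hf =>
  mem_propagate_of_mem (h cl hcl fun f hf' =>
    propagate_induction (H := fun f => f ∈ S) h (fun _ => id) f (hf f hf'))

/-- A round starting from a list that is not closed increases the number of clauses whose head is
present. As this number cannot exceed the number of clauses, one round per clause suffices. -/
theorem closedUnder_saturate (cls : List Clause) : ClosedUnder cls (saturate cls) := by
  classical
  let h : List Fact → ℕ := fun S => cls.countP fun cl => decide (cl.2 ∈ S)
  have hlt (S : List Fact) (hS : ¬ ClosedUnder cls S) : h S < h (propagate cls S) := by
    simp only [ClosedUnder, not_forall] at hS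
    obtain ⟨cl, hcl, hb, hn⟩ := hS
    have hp := mem_propagate hcl hb
    obtain ⟨l₁, l₂, hl⟩ := List.append_of_mem hcl
    have hmono (l : List Clause) : l.countP (fun cl => decide (cl.2 ∈ S)) ≤
        l.countP fun cl => decide (cl.2 ∈ propagate cls S) :=
      List.countP_mono_left fun c _ hc => by
        simp only [decide_eq_true_eq] at hc ⊢
        exact mem_propagate_of_mem hc
    have h1 := hmono l₁
    have h2 := hmono l₂
    simp only [h]
    generalize propagate cls S = S' at *
    rw [hl, List.countP_append, List.countP_append, List.countP_cons, List.countP_cons]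
    simp only [hn, hp, decide_true, decide_false, if_true, Bool.false_eq_true, if_false]
    omega
  have key (l : List Clause) (S : List Fact) :
      ClosedUnder cls (l.foldl (fun S _ => propagate cls S) S) ∨
        h S + l.length ≤ h (l.foldl (fun S _ => propagate cls S) S) := by
    induction l generalizing S with
    | nil => right; simp
    | cons c l ih =>
      rw [List.foldl_cons]
      by_cases hS : ClosedUnder cls S
      · left
        have (l : List Clause) (S : List Fact) (hS : ClosedUnder cls S) :
            ClosedUnder cls (l.foldl (fun S _ => propagate cls S) S) := by
          induction l generalizing S with
          | nil => exact hS
          | cons _ l ih => exact ih _ hS.propagate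
        exact this l _ hS.propagate
      · refine (ih (propagate cls S)).imp_right fun h1 => ?_
        have := hlt S hS
        rw [List.length_cons]
        omega
  rcases key cls [] with h1 | h1
  · exact h1
  -- The counter has reached its maximum, so every head is present and closedness is immediate.
  · have h2 : h (saturate cls) = cls.length :=
      le_antisymm List.countP_le_length (le_trans (Nat.le_add_left _ _) h1)
    rw [List.countP_eq_length] at h2
    exact fun cl hcl _ => by simpa using h2 cl hcl

/-! ### Sublists -/

/-- All sublists of `L`. -/
def allSublists (L : List Tok) : List (List Tok) :=
  L.foldr (fun t B => B ++ B.map fun b => t :: b) [[]]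

theorem sublist_of_mem_allSublists {L b : List Tok} (h : b ∈ allSublists L) : b.Sublist L := by
  induction L generalizing b with
  | nil => simp_all [allSublists]
  | cons t L ih =>
    rcases List.mem_append.1 h with h | h
    · exact (ih h).cons t
    · obtain ⟨b, hb, rfl⟩ := List.mem_map.1 h
      exact (ih hb).cons_cons t

/-- Normal forms are filters of `L`, so these are the only sublists whose presence matters. -/
theorem filter_mem_allSublists (L : List Tok) (p : Tok → Bool) :
    L.filter p ∈ allSublists L := by
  induction L with
  | nil => simp [allSublists]
  | cons t L ih =>
    refine List.mem_append.2 ?_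
    rw [List.filter_cons]
    split_ifs
    · exact Or.inr (List.mem_map_of_mem ih)
    · exact Or.inl ih

theorem mem_norm {L n : List Tok} {t : Tok} : t ∈ norm L n ↔ t ∈ L ∧ t ∈ n := by
  simp [norm]

theorem mem_annotate {L b b' : List Tok} {n : Monomial} :
    b' ∈ annotate L n b ↔
      (∀ v ∈ n, Tok.var v ∈ L) ∧ b' = norm L (n.map Tok.var ++ b) := by
  unfold annotate
  split_ifs with h <;> simp at h <;> simp
  · exact fun _ => h
  · obtain ⟨v, h1, h2⟩ := h
    exact fun h3 => (h2 (h3 v h1)).elim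

/-! ### The clauses as an inductive predicate -/

section
variable (O : List (DLAxiom × Monomial)) (α : DLAxiom) (L : List Tok) (B : List (List Tok))
  (E : List Elem)

/-- `Z` is a subconcept of a left-hand side in the ontology. -/
def Occurs (Z : Concept) : Prop :=
  ∃ C D n, (DLAxiom.gci C D, n) ∈ O ∧ ∃ i ∈ positions C [] [], i.2.2 = Z

/-- The rules of the calculus in declarative form, so that soundness and completeness can argue rule
by rule. -/
inductive IsClause : List Fact → Fact → Prop
  | top {x} : x ∈ E → IsClause [] (.ext .top x [])
  | conj {C D x b b'} : Occurs O (.conj C D) → x ∈ E → b ∈ B → b' ∈ B →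
      IsClause [.ext C x b, .ext D x b'] (.ext (.conj C D) x (norm L (b ++ b')))
  | ex {R C x y b b'} : Occurs O (.ex R C) → x ∈ E → y ∈ E → b ∈ B → b' ∈ B →
      IsClause [.role R x y b, .ext C y b'] (.ext (.ex R C) x (norm L (b ++ b')))
  | gciName {C A n x b b'} : (DLAxiom.gci C (.name A), n) ∈ O → x ∈ E → b ∈ B →
      b' ∈ annotate L n b → IsClause [.ext C x b] (.ext (.name A) x b')
  | gciEx {C R n x b b'} : (DLAxiom.gci C (.ex R), n) ∈ O → x ∈ E → b ∈ B →
      b' ∈ annotate L n b → IsClause [.ext C x b] (.role R x (.anon R b') b')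
  | ri {R S n x y b b'} : (DLAxiom.ri R S, n) ∈ O → x ∈ E → y ∈ E → b ∈ B →
      b' ∈ annotate L n b → IsClause [.role R x y b] (.role S x y b')
  | rr {R A n x y b b'} : (DLAxiom.rr R A, n) ∈ O → x ∈ E → y ∈ E → b ∈ B →
      b' ∈ annotate L n b → IsClause [.role R x y b] (.ext (.name A) y b')
  | ca {A a n b'} : (DLAxiom.ca A a, n) ∈ O → b' ∈ annotate L n [] →
      IsClause [] (.ext (.name A) (.ind a) b')
  | ra {R a c n b'} : (DLAxiom.ra R a c, n) ∈ O → b' ∈ annotate L n [] →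
      IsClause [] (.role R (.ind a) (.ind c) b')
  | itemName {p e A} : (p, e, Concept.name A) ∈ queryItems α →
      IsClause [] (.ext (.name A) (.fresh e) (norm L [.fresh p]))
  | itemEx {p e R C} : (p, e, Concept.ex R C) ∈ queryItems α →
      IsClause [] (.role R (.fresh e) (.fresh (false :: p)) (norm L [.fresh p]))

variable {O α L B E}

theorem isClause_of_mem_conceptClauses {Z : Concept} (hZ : Occurs O Z) {cl : Clause}
    (h : cl ∈ conceptClauses L B E Z) : IsClause O α L B E cl.1 cl.2 := by
  cases Z with
  | top => simp [conceptClauses, Concept.asConj, Concept.asEx] at h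
  | name A => simp [conceptClauses, Concept.asConj, Concept.asEx] at h
  | conj C D =>
    simp [conceptClauses, Concept.asConj, Concept.asEx] at h
    obtain ⟨x, hx, b, hb, b', hb', rfl⟩ := h
    exact .conj hZ hx hb hb'
  | ex R C =>
    simp [conceptClauses, Concept.asConj, Concept.asEx] at h
    obtain ⟨x, hx, y, hy, b, hb, b', hb', rfl⟩ := h
    exact .ex hZ hx hy hb hb'

theorem isClause_of_mem_axiomClauses {p : DLAxiom × Monomial} (hp : p ∈ O) {cl : Clause}
    (h : cl ∈ axiomClauses L B E p) : IsClause O α L B E cl.1 cl.2 := by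
  obtain ⟨a, n⟩ := p
  cases a with
  | gci C D =>
    simp [axiomClauses, DLAxiom.asGci, DLAxiom.asRi, DLAxiom.asRr, DLAxiom.asCa,
      DLAxiom.asRa] at h
    obtain ⟨x, hx, b, hb, b', hb', h⟩ := h
    cases D with
    | name A =>
      simp [RhsConcept.asName, RhsConcept.asEx] at h
      subst h
      exact .gciName hp hx hb hb'
    | ex R =>
      simp [RhsConcept.asName, RhsConcept.asEx] at h
      subst h
      exact .gciEx hp hx hb hb'
  | ri R S =>
    simp [axiomClauses, DLAxiom.asGci, DLAxiom.asRi, DLAxiom.asRr, DLAxiom.asCa,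
      DLAxiom.asRa] at h
    obtain ⟨x, hx, y, hy, b, hb, b', hb', rfl⟩ := h
    exact .ri hp hx hy hb hb'
  | rr R A =>
    simp [axiomClauses, DLAxiom.asGci, DLAxiom.asRi, DLAxiom.asRr, DLAxiom.asCa,
      DLAxiom.asRa] at h
    obtain ⟨x, hx, y, hy, b, hb, b', hb', rfl⟩ := h
    exact .rr hp hx hy hb hb'
  | ca A a =>
    simp [axiomClauses, DLAxiom.asGci, DLAxiom.asRi, DLAxiom.asRr, DLAxiom.asCa,
      DLAxiom.asRa] at h
    obtain ⟨b', hb', rfl⟩ := h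
    exact .ca hp hb'
  | ra R a c =>
    simp [axiomClauses, DLAxiom.asGci, DLAxiom.asRi, DLAxiom.asRr, DLAxiom.asCa,
      DLAxiom.asRa] at h
    obtain ⟨b', hb', rfl⟩ := h
    exact .ra hp hb'

theorem isClause_of_mem_itemClauses {i : List Bool × List Bool × Concept}
    (hi : i ∈ queryItems α) {cl : Clause} (h : cl ∈ itemClauses L i) :
    IsClause O α L B E cl.1 cl.2 := by
  obtain ⟨p, e, C⟩ := i
  cases C with
  | top => simp [itemClauses, Concept.asName, Concept.asEx] at h
  | name A =>
    simp [itemClauses, Concept.asName, Concept.asEx] at h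
    subst h
    exact .itemName hi
  | conj C D => simp [itemClauses, Concept.asName, Concept.asEx] at h
  | ex R C =>
    simp [itemClauses, Concept.asName, Concept.asEx] at h
    subst h
    exact .itemEx hi

theorem isClause_of_mem_clauses {cl : Clause} (h : cl ∈ clauses O α L B E) :
    IsClause O α L B E cl.1 cl.2 := by
  simp only [clauses, List.mem_append, List.mem_map, List.mem_flatMap] at h
  rcases h with ⟨x, hx, rfl⟩ | ⟨⟨a, n⟩, hp, q, hq, i, hi, h⟩ | ⟨p, hp, h⟩ | ⟨i, hi, h⟩
  · exact .top hx
  · cases a with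
    | gci C D =>
      obtain rfl : q = (C, D) := by simpa [DLAxiom.asGci] using hq
      exact isClause_of_mem_conceptClauses ⟨C, D, n, hp, i, hi, rfl⟩ h
    | _ => simp [DLAxiom.asGci] at hq
  · exact isClause_of_mem_axiomClauses hp h
  · exact isClause_of_mem_itemClauses hi h

theorem mem_clauses_of_isClause {fs : List Fact} {f : Fact} (h : IsClause O α L B E fs f) :
    (fs, f) ∈ clauses O α L B E := by
  have hocc {Z : Concept} (hZ : Occurs O Z) {cl : Clause} (h : cl ∈ conceptClauses L B E Z) :
      cl ∈ clauses O α L B E := by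
    obtain ⟨C, D, n, hO, i, hi, rfl⟩ := hZ
    refine List.mem_append_right _ (List.mem_append_left _ (List.mem_flatMap.2
      ⟨_, hO, List.mem_flatMap.2 ⟨(C, D), ?_, List.mem_flatMap.2 ⟨i, hi, h⟩⟩⟩))
    simp [DLAxiom.asGci]
  have hax {p : DLAxiom × Monomial} (hp : p ∈ O) {cl : Clause} (h : cl ∈ axiomClauses L B E p) :
      cl ∈ clauses O α L B E :=
    List.mem_append_right _ (List.mem_append_right _ (List.mem_append_left _
      (List.mem_flatMap.2 ⟨p, hp, h⟩)))
  have hit {i : List Bool × List Bool × Concept} (hi : i ∈ queryItems α) {cl : Clause}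
      (h : cl ∈ itemClauses L i) : cl ∈ clauses O α L B E :=
    List.mem_append_right _ (List.mem_append_right _ (List.mem_append_right _
      (List.mem_flatMap.2 ⟨i, hi, h⟩)))
  cases h with
  | top hx => exact List.mem_append_left _ (List.mem_map.2 ⟨_, hx, rfl⟩)
  | conj hZ hx hb hb' =>
    exact hocc hZ (by simp [conceptClauses, Concept.asConj, Concept.asEx, hx, hb, hb'])
  | ex hZ hx hy hb hb' =>
    exact hocc hZ (by simp [conceptClauses, Concept.asConj, Concept.asEx, hx, hy, hb, hb'])
  | gciName hp hx hb hb' =>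
    exact hax hp (by
      simp [axiomClauses, DLAxiom.asGci, RhsConcept.asName, RhsConcept.asEx, hx, hb, hb'])
  | gciEx hp hx hb hb' =>
    exact hax hp (by
      simp [axiomClauses, DLAxiom.asGci, RhsConcept.asName, RhsConcept.asEx, hx, hb, hb'])
  | ri hp hx hy hb hb' =>
    exact hax hp (by simp [axiomClauses, DLAxiom.asRi, hx, hy, hb, hb'])
  | rr hp hx hy hb hb' =>
    exact hax hp (by simp [axiomClauses, DLAxiom.asRr, hx, hy, hb, hb'])
  | ca hp hb' => exact hax hp (by simp [axiomClauses, DLAxiom.asCa, hb'])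
  | ra hp hb' => exact hax hp (by simp [axiomClauses, DLAxiom.asRa, hb'])
  | itemName hi => exact hit hi (by simp [itemClauses, Concept.asName])
  | itemEx hi => exact hit hi (by simp [itemClauses, Concept.asEx])

end

/-! ### Soundness -/

section
variable {I : Interp}

theorem Interp.mon_congr {m n : Monomial} (h : ∀ v, v ∈ m ↔ v ∈ n) : I.mon m = I.mon n :=
  (I.mon_eq_iff m n).2 h

/-- The monomial denoted by a list of tokens, given monomials for the fresh variables. -/
def Tok.val (g : List Bool → Monomial) : Tok → Monomial
  | .var v => [v]
  | .fresh p => g p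

def tokVal (g : List Bool → Monomial) (b : List Tok) : Monomial := b.flatMap (Tok.val g)

theorem tokVal_append (g : List Bool → Monomial) (b b' : List Tok) :
    tokVal g (b ++ b') = tokVal g b ++ tokVal g b' := List.flatMap_append

theorem tokVal_map_var (g : List Bool → Monomial) (n : Monomial) :
    tokVal g (n.map Tok.var) = n := by
  induction n with
  | nil => rfl
  | cons v n ih => simpa [tokVal, Tok.val] using ih

/-- When all tokens of `n` lie in `L`, normalising changes only order and multiplicity, which a
monomial does not see. -/
theorem mon_tokVal_norm (g : List Bool → Monomial) {L n : List Tok} (h : ∀ t ∈ n, t ∈ L) :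
    I.mon (tokVal g (norm L n)) = I.mon (tokVal g n) := by
  refine I.mon_congr fun v => ?_
  simp only [tokVal, List.mem_flatMap, mem_norm]
  exact ⟨fun ⟨t, h1, h2⟩ => ⟨t, h1.2, h2⟩, fun ⟨t, h1, h2⟩ => ⟨t, ⟨h t h1, h1⟩, h2⟩⟩

theorem mon_tokVal_annotate (g : List Bool → Monomial) {L b b' : List Tok} {n : Monomial}
    (hb : ∀ t ∈ b, t ∈ L) (h : b' ∈ annotate L n b) :
    I.mon (tokVal g b') = I.mon (n ++ tokVal g b) := by
  obtain ⟨h1, rfl⟩ := mem_annotate.1 h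
  rw [mon_tokVal_norm, tokVal_append, tokVal_map_var]
  intro t ht
  rcases List.mem_append.1 ht with ht | ht
  · obtain ⟨v, hv, rfl⟩ := List.mem_map.1 ht
    exact h1 v hv
  · exact hb t ht

variable (f : List Bool → I.Dom) (g : List Bool → Monomial)

/-- `d` is an instance of an element of the saturation. -/
def IsInstance : Elem → I.Dom → Prop
  | .ind a, d => d = I.ind a
  | .anon R b, d => ∃ d', (d', d, I.mon (tokVal g b)) ∈ I.role R
  | .fresh p, d => d = f p

/-- The second half of a role fact is what range restrictions need. The predecessor need not be an
instance of `x`: a shared witness stands for successors of arbitrary elements. -/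
def Fact.Holds : Fact → Prop
  | .ext C x b => ∀ d, IsInstance f g x d → (d, I.mon (tokVal g b)) ∈ I.ext C
  | .role R x y b =>
    (∀ d, IsInstance f g x d → ∃ e, IsInstance f g y e ∧ (d, e, I.mon (tokVal g b)) ∈ I.role R) ∧
    ∀ e, IsInstance f g y e → ∃ d, (d, e, I.mon (tokVal g b)) ∈ I.role R

/-- The facts about a subconcept occurrence hold. -/
def ItemHolds (i : List Bool × List Bool × Concept) : Prop :=
  (∀ A, i.2.2 = .name A → (f i.2.1, I.mon (g i.1)) ∈ I.concept A) ∧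
  ∀ R C, i.2.2 = .ex R C → (f i.2.1, f (false :: i.1), I.mon (g i.1)) ∈ I.role R

variable {f g}

theorem holds_of_isClause {O : List (DLAxiom × Monomial)} (hI : ∀ p ∈ O, I.Sat p.1 p.2)
    {α : DLAxiom} (hα : ∀ i ∈ queryItems α, ItemHolds f g i) {m : Monomial}
    {B : List (List Tok)} (hB : ∀ b ∈ B, ∀ t ∈ b, t ∈ queryToks α m) {E : List Elem}
    {fs : List Fact} {h : Fact} (hc : IsClause O α (queryToks α m) B E fs h)
    (hfs : ∀ h ∈ fs, h.Holds f g) : h.Holds f g := by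
  have happ {b b' : List Tok} (hb : b ∈ B) (hb' : b' ∈ B) :
      I.mon (tokVal g (norm (queryToks α m) (b ++ b'))) =
        I.mon (tokVal g b ++ tokVal g b') := by
    rw [mon_tokVal_norm, tokVal_append]
    intro t ht
    exact (List.mem_append.1 ht).elim (hB b hb t) (hB b' hb' t)
  have hfresh {i : List Bool × List Bool × Concept} (hi : i ∈ queryItems α)
      (ht : Tok.fresh i.1 ∈ itemToks i) :
      I.mon (tokVal g (norm (queryToks α m) [.fresh i.1])) = I.mon (g i.1) := by
    rw [mon_tokVal_norm]
    · simp [tokVal, Tok.val]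
    · intro t h
      rw [List.mem_singleton.1 h]
      exact List.mem_append_right _ (List.mem_flatMap.2 ⟨i, hi, ht⟩)
  cases hc with
  | top hx => exact fun d _ => rfl
  | conj hZ hx hb hb' =>
    have h1 := hfs _ List.mem_cons_self
    have h2 := hfs _ (List.mem_cons_of_mem _ List.mem_cons_self)
    exact fun d hd => ⟨_, _, happ hb hb', h1 d hd, h2 d hd⟩
  | ex hZ hx hy hb hb' =>
    have h1 := hfs _ List.mem_cons_self
    have h2 := hfs _ (List.mem_cons_of_mem _ List.mem_cons_self)
    intro d hd
    obtain ⟨e, he, hde⟩ := h1.1 d hd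
    exact ⟨e, _, _, happ hb hb', hde, h2 e he⟩
  | gciName hp hx hb hb' =>
    have h1 := hfs _ List.mem_cons_self
    intro d hd
    rw [mon_tokVal_annotate g (hB _ hb) hb']
    exact hI _ hp d _ (h1 d hd)
  | gciEx hp hx hb hb' =>
    have h1 := hfs _ List.mem_cons_self
    -- Instances of the witness are by definition the elements with a predecessor along `R` at this
    -- annotation, which settles the second half.
    refine ⟨fun d hd => ?_, fun e he => he⟩
    obtain ⟨e, k, hk, hde⟩ := hI _ hp d _ (h1 d hd)
    dsimp only at hk hde
    rw [← hk, ← mon_tokVal_annotate g (hB _ hb) hb'] at hde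
    exact ⟨e, ⟨d, hde⟩, hde⟩
  | ri hp hx hy hb hb' =>
    have h1 := hfs _ List.mem_cons_self
    simp only [Fact.Holds]
    rw [mon_tokVal_annotate g (hB _ hb) hb']
    refine ⟨fun d hd => ?_, fun e he => ?_⟩
    · obtain ⟨e, he, hde⟩ := h1.1 d hd
      exact ⟨e, he, hI _ hp d e _ hde⟩
    · obtain ⟨d, hde⟩ := h1.2 e he
      exact ⟨d, hI _ hp d e _ hde⟩
  | rr hp hx hy hb hb' =>
    have h1 := hfs _ List.mem_cons_self
    intro e he
    rw [mon_tokVal_annotate g (hB _ hb) hb']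
    obtain ⟨d, hde⟩ := h1.2 e he
    exact hI _ hp e _ ⟨d, _, rfl, hde⟩
  | ca hp hb' =>
    rintro d rfl
    rw [mon_tokVal_annotate g (by simp) hb']
    simpa [tokVal, Interp.ext, Interp.Sat] using hI _ hp
  | ra hp hb' =>
    have h1 := hI _ hp
    simp only [Fact.Holds]
    rw [mon_tokVal_annotate g (by simp) hb']
    simp only [tokVal, List.flatMap_nil, List.append_nil]
    refine ⟨?_, ?_⟩
    · rintro d rfl
      exact ⟨_, rfl, h1⟩
    · rintro e rfl
      exact ⟨_, h1⟩
  | itemName hi =>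
    rintro d rfl
    rw [hfresh hi (by simp [itemToks, Concept.asName])]
    exact (hα _ hi).1 _ rfl
  | itemEx hi =>
    have h1 := (hα _ hi).2 _ _ rfl
    have h2 := hfresh hi
    simp only [Fact.Holds]
    dsimp only at h1 h2
    rw [h2 (by simp [itemToks, Concept.asEx])]
    refine ⟨?_, ?_⟩
    · rintro d rfl
      exact ⟨_, rfl, h1⟩
    · rintro e rfl
      exact ⟨_, h1⟩

/-! ### Instances of a concept as assignments to its positions -/

/-- Positions are extended at the front, so lying below `p` means having `p` as a suffix. This gives
the locality needed to combine assignments. -/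
theorem positions_suffix {C : Concept} {p e : List Bool} {i : List Bool × List Bool × Concept}
    (hi : i ∈ positions C p e) : p <:+ i.1 ∧ (i.2.1 = e ∨ p <:+ i.2.1) := by
  induction C generalizing p e with
  | top => simp [positions] at hi; simp [hi]
  | name A => simp [positions] at hi; simp [hi]
  | conj C D ihC ihD =>
    simp only [positions, List.mem_cons, List.mem_append] at hi
    rcases hi with rfl | hi | hi
    · simp
    · exact ⟨(List.suffix_cons _ _).trans (ihC hi).1,
        (ihC hi).2.imp_right (List.suffix_cons _ _).trans⟩
    · exact ⟨(List.suffix_cons _ _).trans (ihD hi).1,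
        (ihD hi).2.imp_right (List.suffix_cons _ _).trans⟩
  | ex R C ih =>
    simp only [positions, List.mem_cons] at hi
    rcases hi with rfl | hi
    · simp
    · obtain ⟨h1, h2⟩ := ih hi
      refine ⟨(List.suffix_cons _ _).trans h1, Or.inr ?_⟩
      rcases h2 with h2 | h2
      · rw [h2]; exact List.suffix_cons _ _
      · exact (List.suffix_cons _ _).trans h2

theorem itemToks_eq_fresh {i : List Bool × List Bool × Concept} {t : Tok} (h : t ∈ itemToks i) :
    t = .fresh i.1 := by
  obtain ⟨p, e, C⟩ := i
  cases C <;> simp_all [itemToks, Concept.asName, Concept.asEx]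

/-- The fresh variables of a concept. -/
def conceptToks (C : Concept) (p e : List Bool) : List Tok :=
  (positions C p e).flatMap fun i => itemToks i

theorem tokVal_conceptToks_congr {C : Concept} {p e : List Bool} {g g' : List Bool → Monomial}
    (h : ∀ q, p <:+ q → g q = g' q) :
    tokVal g (conceptToks C p e) = tokVal g' (conceptToks C p e) := by
  refine List.flatMap_congr fun t ht => ?_
  obtain ⟨i, hi, ht⟩ := List.mem_flatMap.1 ht
  rw [itemToks_eq_fresh ht]
  exact h _ (positions_suffix hi).1

theorem not_cons_suffix {b : Bool} {p q : List Bool} (h : q <:+ p) : ¬ (b :: p) <:+ q := by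
  intro h'
  have h1 := h.length_le
  have h2 := h'.length_le
  rw [List.length_cons] at h2
  omega

/-- A membership in `C` comes from an assignment to the positions of `C`. -/
theorem exists_assignment (C : Concept) {p e : List Bool} (hpe : e <:+ p)
    (f : List Bool → I.Dom) (g : List Bool → Monomial) {n : Monomial}
    (h : (f e, I.mon n) ∈ I.ext C) :
    ∃ (f' : List Bool → I.Dom) (g' : List Bool → Monomial),
      (∀ q, q = p ∨ ¬ p <:+ q → f' q = f q) ∧ (∀ q, ¬ p <:+ q → g' q = g q) ∧
      (∀ i ∈ positions C p e, ItemHolds f' g' i) ∧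
      I.mon n = I.mon (tokVal g' (conceptToks C p e)) := by
  have he : e = p ∨ ¬ p <:+ e := by
    by_cases h : p <:+ e
    · exact Or.inl (hpe.eq_of_length (le_antisymm hpe.length_le h.length_le))
    · exact Or.inr h
  induction C generalizing p e f g n with
  | top =>
    refine ⟨f, g, fun _ _ => rfl, fun _ _ => rfl, ?_, ?_⟩
    · simp [positions, ItemHolds]
    · simpa [conceptToks, positions, itemToks, Concept.asName, Concept.asEx, tokVal,
        Interp.ext] using h
  | name A =>
    refine ⟨f, Function.update g p n, fun _ _ => rfl, fun q hq => ?_, ?_, ?_⟩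
    · exact Function.update_of_ne (by rintro rfl; exact hq (List.suffix_refl _)) _ _
    · simpa [positions, ItemHolds, Interp.ext] using h
    · simp [conceptToks, positions, itemToks, Concept.asName, Concept.asEx, tokVal, Tok.val]
  | conj C D ihC ihD =>
    obtain ⟨n₁, n₂, hn, h1, h2⟩ := h
    dsimp only at hn h1 h2
    have hee (b : Bool) : ¬ (b :: p) <:+ e := not_cons_suffix hpe
    obtain ⟨f₁, g₁, hf₁, hg₁, hi₁, hn₁⟩ := ihC (p := false :: p)
      (hpe.trans (List.suffix_cons _ _)) f g h1 (Or.inr (hee _))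
    rw [← hf₁ e (Or.inr (hee _))] at h2
    obtain ⟨f₂, g₂, hf₂, hg₂, hi₂, hn₂⟩ := ihD (p := true :: p)
      (hpe.trans (List.suffix_cons _ _)) f₁ g₁ h2 (Or.inr (hee _))
    -- Nothing lies below both children of a conjunction, so the assignment for the second conjunct
    -- leaves that for the first intact.
    have hdis {q : List Bool} (hq : (false :: p) <:+ q) : ¬ (true :: p) <:+ q := by
      intro hq'
      have := (List.suffix_of_suffix_length_le hq hq' (by simp)).eq_of_length (by simp)
      simp at this
    have hg {q : List Bool} (hq : (false :: p) <:+ q) : g₂ q = g₁ q := hg₂ q (hdis hq)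
    have hf {q : List Bool} (hq : (false :: p) <:+ q) : f₂ q = f₁ q := hf₂ q (Or.inr (hdis hq))
    have hnot {b : Bool} {q : List Bool} (hq : q = p ∨ ¬ p <:+ q) : ¬ (b :: p) <:+ q := by
      rcases hq with rfl | hq
      · exact not_cons_suffix (List.suffix_refl _)
      · exact fun h' => hq ((List.suffix_cons _ _).trans h')
    refine ⟨f₂, g₂, fun q hq => ?_, fun q hq => ?_, fun i hi => ?_, ?_⟩
    · rw [hf₂ q (Or.inr (hnot hq)), hf₁ q (Or.inr (hnot hq))]
    · rw [hg₂ q (hnot (Or.inr hq)), hg₁ q (hnot (Or.inr hq))]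
    · simp only [positions, List.mem_cons, List.mem_append] at hi
      rcases hi with rfl | hi | hi
      · simp [ItemHolds]
      · obtain ⟨h3, h4⟩ := positions_suffix hi
        have h5 : f₂ i.2.1 = f₁ i.2.1 := by
          rcases h4 with h4 | h4
          · rw [h4]; exact hf₂ e (Or.inr (hee _))
          · exact hf h4
        have h6 := hi₁ i hi
        unfold ItemHolds at h6 ⊢
        rwa [h5, hg h3, hf (h3.trans (List.suffix_cons _ _))]
      · exact hi₂ i hi
    · rw [hn]
      have h3 : conceptToks (.conj C D) p e =
          conceptToks C (false :: p) e ++ conceptToks D (true :: p) e := by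
        simp [conceptToks, positions, itemToks, Concept.asName, Concept.asEx]
      rw [h3, tokVal_append, tokVal_conceptToks_congr fun q hq => hg hq]
      rw [I.mon_eq_iff] at hn₁ hn₂
      refine I.mon_congr fun v => ?_
      rw [List.mem_append, List.mem_append, hn₁ v, hn₂ v]
  | ex R C ih =>
    obtain ⟨e₀, n₁, n₂, hn, h1, h2⟩ := h
    dsimp only at hn h1 h2
    have hpp : ¬ (false :: p) <:+ p := not_cons_suffix (List.suffix_refl _)
    -- The successor and the annotation of the role are stored before the recursion. The successor
    -- sits at the root position of `C`, which is why assignments of elements must be preserved also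
    -- at the root, whereas those of monomials need not be.
    obtain ⟨f', g', hf, hg, hi, hn'⟩ := ih (p := false :: p) (List.suffix_refl _)
      (Function.update f (false :: p) e₀) (Function.update g p n₁) (n := n₂) (by simpa using h2)
      (Or.inl rfl)
    have hnot {q : List Bool} (hq : q = p ∨ ¬ p <:+ q) : ¬ (false :: p) <:+ q := by
      rcases hq with rfl | hq
      · exact hpp
      · exact fun h' => hq ((List.suffix_cons _ _).trans h')
    have hfq {q : List Bool} (hq : q = p ∨ ¬ p <:+ q) : f' q = f q := by
      rw [hf q (Or.inr (hnot hq))]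
      exact Function.update_of_ne (by rintro rfl; exact hnot hq (List.suffix_refl _)) _ _
    have hgp : g' p = n₁ := by rw [hg p hpp]; simp
    refine ⟨f', g', fun q hq => hfq hq, fun q hq => ?_, fun i hi' => ?_, ?_⟩
    · rw [hg q (hnot (Or.inr hq))]
      exact Function.update_of_ne (by rintro rfl; exact hq (List.suffix_refl _)) _ _
    · simp only [positions, List.mem_cons] at hi'
      rcases hi' with rfl | hi'
      · refine ⟨by simp, fun S D hS => ?_⟩
        obtain ⟨rfl, rfl⟩ := Concept.ex.inj hS
        dsimp only
        rw [hfq he, hgp, hf _ (Or.inl rfl)]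
        simpa using h1
      · exact hi i hi'
    · rw [hn]
      have h3 : conceptToks (.ex R C) p e =
          .fresh p :: conceptToks C (false :: p) (false :: p) := by
        simp [conceptToks, positions, itemToks, Concept.asName, Concept.asEx]
      rw [h3]
      rw [I.mon_eq_iff] at hn'
      refine I.mon_congr fun v => ?_
      rw [List.mem_append, hn' v]
      simp [tokVal, Tok.val, hgp]

end

/-! ### Correctness of positive answers -/

/-- An instance of the left-hand side at `n` yields values of the fresh symbols under which `L`
denotes `m ++ n`. The derived goal then holds in the model for these values. -/
theorem entails_of_decideEntails {O : List (DLAxiom × Monomial)} {α : DLAxiom} {m : Monomial}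
    (h : decideEntails O α (queryToks α m) (allSublists (queryToks α m)) = true) (I : Interp)
    (hI : ∀ p ∈ O, I.Sat p.1 p.2) : I.Sat α m := by
  simp only [decideEntails, List.any_eq_true, memb_iff] at h
  obtain ⟨F, hF, hS⟩ := h
  have key (f : List Bool → I.Dom) (g : List Bool → Monomial)
      (hα : ∀ i ∈ queryItems α, ItemHolds f g i) : F.Holds f g :=
    saturate_induction (H := fun F => F.Holds f g) (fun cl hcl => holds_of_isClause hI hα
      (fun b hb t ht => (sublist_of_mem_allSublists hb).subset ht)
      (isClause_of_mem_clauses hcl)) F hS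
  have hval (g : List Bool → Monomial) :
      tokVal g (queryToks α m) = m ++ tokVal g ((queryItems α).flatMap fun i => itemToks i) := by
    rw [queryToks, tokVal_append, tokVal_map_var]
  cases α with
  | gci C D =>
    intro d n hd
    obtain ⟨f, g, hf, -, hi, hn⟩ := exists_assignment C (List.suffix_refl []) (fun _ => d)
      (fun _ => []) hd
    have hq : queryItems (.gci C D) = positions C [] [] := by
      simp [queryItems, queryConcepts, DLAxiom.asGci, DLAxiom.asRi, DLAxiom.asRr]
    have hf0 : f [] = d := hf [] (Or.inl rfl)
    have h1 := key f g (by rw [hq]; exact hi)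
    have h2 : I.mon (tokVal g (queryToks (.gci C D) m)) = I.mon (m ++ n) := by
      rw [hval, hq]
      rw [I.mon_eq_iff] at hn
      refine I.mon_congr fun v => ?_
      rw [List.mem_append, List.mem_append, hn v, conceptToks]
    cases D with
    | name A =>
      simp [goals, DLAxiom.asGci, DLAxiom.asRi, DLAxiom.asRr, DLAxiom.asCa, DLAxiom.asRa,
        RhsConcept.asName, RhsConcept.asEx] at hF
      subst hF
      have h3 := h1 d hf0.symm
      rw [h2] at h3
      exact h3
    | ex R =>
      simp [goals, DLAxiom.asGci, DLAxiom.asRi, DLAxiom.asRr, DLAxiom.asCa, DLAxiom.asRa,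
        RhsConcept.asName, RhsConcept.asEx] at hF
      obtain ⟨y, hy, rfl⟩ := hF
      obtain ⟨e, -, he⟩ := h1.1 d hf0.symm
      rw [h2] at he
      exact ⟨e, _, rfl, he⟩
  | ri R S =>
    intro d e n hd
    have hq : queryItems (.ri R S) =
        [([], [], .ex R .top), ([false], [false], .top)] := by
      simp [queryItems, queryConcepts, DLAxiom.asGci, DLAxiom.asRi, DLAxiom.asRr, positions]
    -- The universal instance of `∃R.⊤` has its two ends at `[]` and `[false]` and a single fresh
    -- variable, which takes the value `n`.
    have h1 := key (fun q => if q = [] then d else e) (fun _ => n) (by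
      rw [hq]
      simp only [List.mem_cons, List.not_mem_nil, or_false, forall_eq_or_imp, forall_eq,
        ItemHolds]
      refine ⟨⟨by simp, fun S D h => ?_⟩, by simp, by simp⟩
      obtain ⟨rfl, rfl⟩ := Concept.ex.inj h
      simpa using hd)
    simp [goals, DLAxiom.asGci, DLAxiom.asRi, DLAxiom.asRr, DLAxiom.asCa, DLAxiom.asRa] at hF
    subst hF
    obtain ⟨e', he', h2⟩ := h1.1 d rfl
    obtain rfl : e' = e := by simpa [IsInstance] using he'
    rw [hval, hq] at h2
    simpa [itemToks, Concept.asName, Concept.asEx, tokVal, Tok.val, Interp.ext] using h2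
  | rr R A =>
    rintro e n ⟨d, k, hk, hd⟩
    dsimp only at hk hd
    rw [← hk] at hd
    have hq : queryItems (.rr R A) =
        [([], [], .ex R .top), ([false], [false], .top)] := by
      simp [queryItems, queryConcepts, DLAxiom.asGci, DLAxiom.asRi, DLAxiom.asRr, positions]
    have h1 := key (fun q => if q = [] then d else e) (fun _ => n) (by
      rw [hq]
      simp only [List.mem_cons, List.not_mem_nil, or_false, forall_eq_or_imp, forall_eq,
        ItemHolds]
      refine ⟨⟨by simp, fun S D h => ?_⟩, by simp, by simp⟩
      obtain ⟨rfl, rfl⟩ := Concept.ex.inj h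
      simpa using hd)
    simp [goals, DLAxiom.asGci, DLAxiom.asRi, DLAxiom.asRr, DLAxiom.asCa, DLAxiom.asRa] at hF
    subst hF
    have h2 := h1 e (by simp [IsInstance])
    rw [hval, hq] at h2
    simpa [itemToks, Concept.asName, Concept.asEx, tokVal, Tok.val, Interp.ext] using h2
  | ca A a =>
    have hq : queryItems (.ca A a) = [] := by
      simp [queryItems, queryConcepts, DLAxiom.asGci, DLAxiom.asRi, DLAxiom.asRr]
    have h1 := key (fun _ => I.ind a) (fun _ => []) (by simp [hq])
    simp [goals, DLAxiom.asGci, DLAxiom.asRi, DLAxiom.asRr, DLAxiom.asCa, DLAxiom.asRa] at hF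
    subst hF
    have h2 := h1 _ rfl
    rw [hval, hq] at h2
    simpa [tokVal, Interp.ext, Interp.Sat] using h2
  | ra R a c =>
    have hq : queryItems (.ra R a c) = [] := by
      simp [queryItems, queryConcepts, DLAxiom.asGci, DLAxiom.asRi, DLAxiom.asRr]
    have h1 := key (fun _ => I.ind a) (fun _ => []) (by simp [hq])
    simp [goals, DLAxiom.asGci, DLAxiom.asRi, DLAxiom.asRr, DLAxiom.asCa, DLAxiom.asRa] at hF
    subst hF
    obtain ⟨e, rfl, h2⟩ := h1.1 _ rfl
    rw [hval, hq] at h2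
    simpa [tokVal, Interp.ext, Interp.Sat] using h2

/-! ### Completeness -/

/-- The number of a variable of the saturation; the fresh ones come after `K`. -/
def Tok.number (K : ℕ) : Tok → ℕ
  | .var v => v
  | .fresh p => K + Encodable.encode p

/-- The set of numbers of the variables in `L`. -/
def numbers (K : ℕ) (L : List Tok) : Finset ℕ := (L.map (Tok.number K)).toFinset

/-- The variables in `L` whose numbers are in `s`. -/
def toksIn (K : ℕ) (L : List Tok) (s : Finset ℕ) : List Tok :=
  L.filter fun t => decide (t.number K ∈ s)

section
variable {K : ℕ} {L : List Tok}

theorem toksIn_union (s s' : Finset ℕ) :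
    toksIn K L (s ∪ s') = norm L (toksIn K L s ++ toksIn K L s') := by
  refine List.filter_congr fun t ht => ?_
  rw [Bool.eq_iff_iff]
  simp [toksIn, ht]

theorem toksIn_numbers : toksIn K L (numbers K L) = L := by
  refine List.filter_eq_self.2 fun t ht => ?_
  simp only [numbers, decide_eq_true_eq, List.mem_toFinset, List.mem_map]
  exact ⟨t, ht, rfl⟩

theorem toksIn_mem_allSublists (s : Finset ℕ) : toksIn K L s ∈ allSublists L :=
  filter_mem_allSublists _ _

theorem toksIn_fresh (hL : ∀ v, Tok.var v ∈ L → v < K) (p : List Bool) :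
    toksIn K L ([(Tok.fresh p).number K].toFinset) = norm L [.fresh p] := by
  refine List.filter_congr fun t ht => ?_
  rw [Bool.eq_iff_iff]
  cases t with
  | var v =>
    have h1 : v < K := hL v ht
    have h2 : v ≠ K + Encodable.encode p := fun h => by
      rw [h] at h1
      exact absurd h1 (by simp)
    simpa [Tok.number] using h2
  | fresh q => simp [Tok.number]

/-- Variables of the ontology lie below `K`, hence are not confused with fresh ones. If their
numbers occur in `L`, the variables themselves do. -/
theorem toksIn_mem_annotate {n k : Monomial}
    (hn : ∀ v ∈ n, v < K) (h : (n ++ k).toFinset ⊆ numbers K L) :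
    toksIn K L (n ++ k).toFinset ∈ annotate L n (toksIn K L k.toFinset) := by
  refine mem_annotate.2 ⟨fun v hv => ?_, ?_⟩
  · have h1 := h (List.mem_toFinset.2 (List.mem_append_left k hv))
    simp only [numbers, List.mem_toFinset, List.mem_map] at h1
    obtain ⟨t, ht, h2⟩ := h1
    cases t with
    | var w => rw [← show w = v from h2]; exact ht
    | fresh p =>
      have h3 : v < K := hn v hv
      rw [← h2] at h3
      exact absurd h3 (by simp [Tok.number])
  · refine List.filter_congr fun t ht => ?_
    rw [Bool.eq_iff_iff]
    cases t with
    | var v => simp [toksIn, ht, Tok.number]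
    | fresh p =>
      have : K + Encodable.encode p ∉ n := fun h3 =>
        absurd (hn _ h3) (by simp)
      simp [toksIn, ht, Tok.number, this]

end

section
variable (K : ℕ) (L : List Tok) (E : List Elem) (S : List Fact)

open Classical in
/-- The interpretation given by a list of facts. Everything holds at monomials that do not
divide `L`. -/
noncomputable def canonicalModel (h0 : Elem.fresh [] ∈ E) : Interp where
  Dom := {x // x ∈ E}
  MonDom := Finset ℕ
  dom_nonempty := ⟨⟨_, h0⟩⟩
  monDom_nonempty := ⟨∅⟩
  -- For `E` given by `elems`, an individual outside `E` occurs neither in the ontology nor in the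
  -- query, so its value is irrelevant.
  ind a := if h : Elem.ind a ∈ E then ⟨_, h⟩ else ⟨_, h0⟩
  concept A := {p | p.2 ⊆ numbers K L → .ext (.name A) p.1.1 (toksIn K L p.2) ∈ S}
  role R := {p | p.2.2 ⊆ numbers K L → .role R p.1.1 p.2.1.1 (toksIn K L p.2.2) ∈ S}
  mon m := m.toFinset
  mon_eq_iff m n := by simp [Finset.ext_iff, TrioEquiv]

end

theorem self_mem_positions (C : Concept) (p e : List Bool) : (p, e, C) ∈ positions C p e := by
  cases C <;> simp [positions]

section
variable {O : List (DLAxiom × Monomial)} {α : DLAxiom} {L : List Tok} {K : ℕ}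

theorem fresh_nil_mem_elems (O : List (DLAxiom × Monomial)) (α : DLAxiom)
    (B : List (List Tok)) : Elem.fresh [] ∈ elems O α B := by
  simp [elems]

theorem fresh_mem_elems {i : List Bool × List Bool × Concept} (hi : i ∈ queryItems α)
    (B : List (List Tok)) : Elem.fresh i.2.1 ∈ elems O α B := by
  refine List.mem_append_right _ (List.mem_append_right _ (List.mem_cons_of_mem _ ?_))
  exact List.mem_map.2 ⟨i, hi, rfl⟩

theorem anon_mem_elems {C : Concept} {R : RoleName} {n : Monomial}
    (h : (DLAxiom.gci C (.ex R), n) ∈ O) {B : List (List Tok)} {b : List Tok} (hb : b ∈ B) :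
    Elem.anon R b ∈ elems O α B := by
  refine List.mem_append_right _ (List.mem_append_left _ (List.mem_flatMap.2 ⟨R, ?_, ?_⟩))
  · exact List.mem_flatMap.2 ⟨_, h, by simp [axiomRoles, DLAxiom.asGci, RhsConcept.asEx]⟩
  · exact List.mem_map.2 ⟨b, hb, rfl⟩

theorem ind_mem_elems {a : IndName}
    (h : (∃ p ∈ O, a ∈ axiomInds p.1) ∨ a ∈ axiomInds α) (B : List (List Tok)) :
    Elem.ind a ∈ elems O α B := by
  refine List.mem_append_left _ (List.mem_map.2 ⟨a, ?_, rfl⟩)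
  rw [List.mem_append, List.mem_flatMap]
  exact h

variable (O α L)

/-- The facts derived by the algorithm. -/
noncomputable def derived : List Fact :=
  saturate (clauses O α L (allSublists L) (elems O α (allSublists L)))

variable (K) in
noncomputable def derivedModel : Interp :=
  canonicalModel K L (elems O α (allSublists L)) (derived O α L) (fresh_nil_mem_elems O α _)

variable {O α L}

theorem mem_derived {fs : List Fact} {f : Fact}
    (h : IsClause O α L (allSublists L) (elems O α (allSublists L)) fs f)
    (hfs : ∀ f ∈ fs, f ∈ derived O α L) : f ∈ derived O α L :=
  closedUnder_saturate _ _ (mem_clauses_of_isClause h) hfs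

/-- If a product divides `L`, so do its factors. Evaluating a concept at a divisor of `L` thus never
relies on the convention for other monomials, and each step is matched by a clause. -/
theorem ext_mem_derived (C : Concept) {p e : List Bool}
    (hC : ∀ i ∈ positions C p e, Occurs O i.2.2) (x : {x // x ∈ elems O α (allSublists L)})
    (s : Finset ℕ) (hs : s ⊆ numbers K L) (h : (x, s) ∈ (derivedModel O α L K).ext C) :
    Fact.ext C x.1 (toksIn K L s) ∈ derived O α L := by
  induction C generalizing p e x s with
  | top =>
    obtain rfl : s = ∅ := h
    have : toksIn K L ∅ = [] := by simp [toksIn]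
    rw [this]
    exact mem_derived (.top x.2) (by simp)
  | name A => exact h hs
  | conj C D ihC ihD =>
    obtain ⟨m, n, hmn, h1, h2⟩ := h
    obtain rfl : s = (m ++ n).toFinset := hmn
    rw [List.toFinset_append] at hs ⊢
    rw [toksIn_union]
    have h3 := ihC (p := false :: p) (e := e) (fun i hi => hC i (by simp [positions, hi])) x _
      (Finset.union_subset_left hs) h1
    have h4 := ihD (p := true :: p) (e := e) (fun i hi => hC i (by simp [positions, hi])) x _
      (Finset.union_subset_right hs) h2
    refine mem_derived (.conj (hC _ (self_mem_positions _ p e)) x.2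
      (toksIn_mem_allSublists _) (toksIn_mem_allSublists _)) ?_
    simp [h3, h4]
  | ex R C ih =>
    obtain ⟨y, m, n, hmn, h1, h2⟩ := h
    obtain rfl : s = (m ++ n).toFinset := hmn
    rw [List.toFinset_append] at hs ⊢
    rw [toksIn_union]
    have h3 := h1 (Finset.union_subset_left hs)
    have h4 := ih (p := false :: p) (e := false :: p)
      (fun i hi => hC i (by simp [positions, hi])) y _ (Finset.union_subset_right hs) h2
    refine mem_derived (.ex (hC _ (self_mem_positions _ p e)) x.2 y.2
      (toksIn_mem_allSublists _) (toksIn_mem_allSublists _)) ?_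
    simp only [List.mem_cons, List.not_mem_nil, or_false, forall_eq_or_imp, forall_eq]
    exact ⟨h3, h4⟩

theorem ind_derivedModel {a : IndName} (h : (∃ p ∈ O, a ∈ axiomInds p.1) ∨ a ∈ axiomInds α) :
    (derivedModel O α L K).ind a = ⟨.ind a, ind_mem_elems h _⟩ :=
  dif_pos (ind_mem_elems h _)

/-- Either the product of the axiom's annotation with the premise's divides `L`, and then a clause
applies, or the conclusion holds by convention. -/
theorem sat_derivedModel
    (hK : ∀ p ∈ O, ∀ v ∈ p.2, v < K) : ∀ p ∈ O, (derivedModel O α L K).Sat p.1 p.2 := by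
  rintro ⟨a, n⟩ hp
  have hann {k : Monomial} (h : (n ++ k).toFinset ⊆ numbers K L) :=
    toksIn_mem_annotate (hK _ hp) h
  have hright {k : Monomial} (h : (n ++ k).toFinset ⊆ numbers K L) :
      k.toFinset ⊆ numbers K L := by
    rw [List.toFinset_append] at h
    exact Finset.union_subset_right h
  have hB := toksIn_mem_allSublists (K := K) (L := L)
  cases a with
  | gci C D =>
    intro x k hx
    have hC : ∀ i ∈ positions C [] [], Occurs O i.2.2 := fun i hi => ⟨C, D, n, hp, i, hi, rfl⟩
    cases D with
    | name A =>
      intro h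
      have h1 := ext_mem_derived C hC x _ (hright h) hx
      exact mem_derived (.gciName hp x.2 (hB _) (hann h)) (by simpa using h1)
    | ex R =>
      by_cases h : (n ++ k).toFinset ⊆ numbers K L
      · have h1 := ext_mem_derived C hC x _ (hright h) hx
        have h2 := mem_derived (.gciEx hp x.2 (hB _) (hann h)) (by simpa using h1)
        exact ⟨⟨_, anon_mem_elems hp (hB _)⟩, n ++ k, rfl, fun _ => h2⟩
      -- At a monomial not dividing `L` all role triples are present, so any element serves as a
      -- successor.
      · exact ⟨x, n ++ k, rfl, fun h' => (h h').elim⟩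
  | ri R S =>
    intro x y k hx h
    exact mem_derived (.ri hp x.2 y.2 (hB _) (hann h))
      (List.forall_mem_singleton.2 (hx (hright h)))
  | rr R A =>
    rintro y k ⟨x, k', hk, hx⟩ h
    dsimp only at hk hx
    rw [← hk] at hx
    exact mem_derived (.rr hp x.2 y.2 (hB _) (hann h))
      (List.forall_mem_singleton.2 (hx (hright h)))
  | ca A a =>
    intro h
    have h1 : a ∈ axiomInds (.ca A a) := by simp [axiomInds, DLAxiom.asCa]
    rw [ind_derivedModel (Or.inl ⟨_, hp, h1⟩)]
    have h2 := hann (k := []) (by rw [List.append_nil]; exact h)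
    simp only [List.append_nil] at h2
    have h3 : toksIn K L (([] : Monomial).toFinset) = [] := by simp [toksIn]
    rw [h3] at h2
    exact mem_derived (.ca hp h2) (by simp)
  | ra R a c =>
    intro h
    have h1 : a ∈ axiomInds (.ra R a c) := by simp [axiomInds, DLAxiom.asRa]
    have h1' : c ∈ axiomInds (.ra R a c) := by simp [axiomInds, DLAxiom.asRa]
    rw [ind_derivedModel (Or.inl ⟨_, hp, h1⟩), ind_derivedModel (Or.inl ⟨_, hp, h1'⟩)]
    have h2 := hann (k := []) (by rw [List.append_nil]; exact h)
    simp only [List.append_nil] at h2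
    have h3 : toksIn K L (([] : Monomial).toFinset) = [] := by simp [toksIn]
    rw [h3] at h2
    exact mem_derived (.ra hp h2) (by simp)

/-- The universal instance of the queried concept. -/
theorem mem_ext_derivedModel (hL : ∀ v, Tok.var v ∈ L → v < K) (C : Concept) {p e : List Bool}
    (hC : ∀ i ∈ positions C p e, i ∈ queryItems α)
    (he : Elem.fresh e ∈ elems O α (allSublists L)) :
    ((⟨_, he⟩ : {x // x ∈ elems O α (allSublists L)}),
      ((conceptToks C p e).map (Tok.number K)).toFinset) ∈ (derivedModel O α L K).ext C := by
  induction C generalizing p e with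
  | top => rfl
  | name A =>
    intro _
    have : conceptToks (.name A) p e = [.fresh p] := by
      simp [conceptToks, positions, itemToks, Concept.asName, Concept.asEx]
    dsimp only
    rw [this, List.map_singleton, toksIn_fresh hL]
    exact mem_derived (.itemName (hC _ (self_mem_positions _ p e))) (by simp)
  | conj C D ihC ihD =>
    have : conceptToks (.conj C D) p e =
        conceptToks C (false :: p) e ++ conceptToks D (true :: p) e := by
      simp [conceptToks, positions, itemToks, Concept.asName, Concept.asEx]
    rw [this, List.map_append]
    exact ⟨_, _, rfl, ihC (fun i hi => hC i (by simp [positions, hi])) he,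
      ihD (fun i hi => hC i (by simp [positions, hi])) he⟩
  | ex R C ih =>
    have : conceptToks (.ex R C) p e =
        [.fresh p] ++ conceptToks C (false :: p) (false :: p) := by
      simp [conceptToks, positions, itemToks, Concept.asName, Concept.asEx]
    rw [this, List.map_append]
    have h1 : ∀ i ∈ positions C (false :: p) (false :: p), i ∈ queryItems α :=
      fun i hi => hC i (by simp [positions, hi])
    have h2 := fresh_mem_elems (O := O) (h1 _ (self_mem_positions _ _ _)) (allSublists L)
    refine ⟨⟨_, h2⟩, _, _, rfl, fun _ => ?_, ih h1 h2⟩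
    dsimp only
    rw [List.map_singleton]
    change Fact.role R _ _ (toksIn K L ([(Tok.fresh p).number K].toFinset)) ∈ _
    rw [toksIn_fresh hL]
    exact mem_derived (.itemEx (hC _ (self_mem_positions _ p e))) (by simp)

end

/-- The entailment is applied in the derived model to the queried individuals or to the universal
instance. The resulting annotation is all of `L`, which divides `L`, so the conclusion is a derived
fact rather than one true by convention. -/
theorem decideEntails_of_entails {O : List (DLAxiom × Monomial)} {α : DLAxiom} {m : Monomial}
    (h : ∀ I : Interp, (∀ p ∈ O, I.Sat p.1 p.2) → I.Sat α m) :
    decideEntails O α (queryToks α m) (allSublists (queryToks α m)) = true := by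
  obtain ⟨K, hK⟩ : ∃ K, ∀ v ∈ m ++ O.flatMap (fun p => p.2), v < K :=
    ⟨(m ++ O.flatMap fun p => p.2).sum + 1, fun v hv => Nat.lt_succ_of_le (List.le_sum_of_mem hv)⟩
  have hL : ∀ v, Tok.var v ∈ queryToks α m → v < K := by
    intro v hv
    rcases List.mem_append.1 hv with hv | hv
    · obtain ⟨w, hw, hwv⟩ := List.mem_map.1 hv
      obtain rfl := Tok.var.inj hwv
      exact hK _ (List.mem_append_left _ hw)
    · obtain ⟨i, -, hi⟩ := List.mem_flatMap.1 hv
      cases itemToks_eq_fresh hi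
  have hO : ∀ p ∈ O, ∀ v ∈ p.2, v < K := fun p hp v hv =>
    hK v (List.mem_append_right _ (List.mem_flatMap.2 ⟨p, hp, hv⟩))
  have hsat := h (derivedModel O α (queryToks α m) K) (sat_derivedModel hO)
  have hnum : numbers K (queryToks α m) = (m ++ ((queryItems α).flatMap fun i =>
      itemToks i).map (Tok.number K)).toFinset := by
    rw [numbers, queryToks, List.map_append, List.map_map]
    congr 2
    exact List.map_id _
  suffices hs : ∃ F ∈ goals α (queryToks α m) (elems O α (allSublists (queryToks α m))),
      F ∈ derived O α (queryToks α m) by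
    simpa [decideEntails, derived] using hs
  have hself := toksIn_numbers (K := K) (L := queryToks α m)
  cases α with
  | gci C D =>
    have hq : queryItems (.gci C D) = positions C [] [] := by
      simp [queryItems, queryConcepts, DLAxiom.asGci, DLAxiom.asRi, DLAxiom.asRr]
    have h1 := mem_ext_derivedModel (O := O) (α := .gci C D) hL C (p := []) (e := [])
      (by rw [hq]; exact fun _ => id) (fresh_nil_mem_elems _ _ _)
    have h2 := hsat _ _ h1
    rw [hq] at hnum
    cases D with
    | name A =>
      have h3 := h2 hnum.ge
      change Fact.ext _ _ (toksIn K _ (m ++ _).toFinset) ∈ _ at h3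
      unfold conceptToks at h3
      rw [← hnum, hself] at h3
      exact ⟨_, by simp [goals, DLAxiom.asGci, RhsConcept.asName], h3⟩
    | ex R =>
      obtain ⟨y, k, hk, h3⟩ := h2
      have hk' : numbers K (queryToks (.gci C (.ex R)) m) = k.toFinset := hnum.trans hk
      have h4 := h3 hk'.ge
      change Fact.role _ _ _ (toksIn K _ k.toFinset) ∈ _ at h4
      rw [← hk', hself] at h4
      refine ⟨_, ?_, h4⟩
      simp [goals, DLAxiom.asGci, RhsConcept.asEx, RhsConcept.asName]
      exact Or.inl y.2
  | ri R S =>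
    have hq : queryItems (.ri R S) =
        [([], [], .ex R .top), ([false], [false], .top)] := by
      simp [queryItems, queryConcepts, DLAxiom.asGci, DLAxiom.asRi, DLAxiom.asRr, positions]
    have h0 := fresh_nil_mem_elems O (.ri R S) (allSublists (queryToks (.ri R S) m))
    have h0' := fresh_mem_elems (O := O) (α := .ri R S) (i := ([false], [false], .top))
      (by simp [hq]) (allSublists (queryToks (.ri R S) m))
    have h1 := hsat ⟨_, h0⟩ ⟨_, h0'⟩ [(Tok.fresh []).number K] (fun _ => by
      change Fact.role _ _ _ (toksIn K _ [(Tok.fresh []).number K].toFinset) ∈ _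
      rw [toksIn_fresh hL]
      exact mem_derived (.itemEx (C := .top) (by simp [hq])) (by simp))
    have h2 : numbers K (queryToks (.ri R S) m) = (m ++ [(Tok.fresh []).number K]).toFinset := by
      rw [hnum, hq]
      simp [itemToks, Concept.asName, Concept.asEx]
    have h3 := h1 h2.ge
    change Fact.role _ _ _ (toksIn K _ (m ++ _).toFinset) ∈ _ at h3
    rw [← h2, hself] at h3
    exact ⟨_, by simp [goals, DLAxiom.asRi], h3⟩
  | rr R A =>
    have hq : queryItems (.rr R A) =
        [([], [], .ex R .top), ([false], [false], .top)] := by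
      simp [queryItems, queryConcepts, DLAxiom.asGci, DLAxiom.asRi, DLAxiom.asRr, positions]
    have h0 := fresh_nil_mem_elems O (.rr R A) (allSublists (queryToks (.rr R A) m))
    have h0' := fresh_mem_elems (O := O) (α := .rr R A) (i := ([false], [false], .top))
      (by simp [hq]) (allSublists (queryToks (.rr R A) m))
    have h1 := hsat ⟨_, h0'⟩ [(Tok.fresh []).number K] ⟨⟨_, h0⟩, _, rfl, fun _ => by
      change Fact.role _ _ _ (toksIn K _ [(Tok.fresh []).number K].toFinset) ∈ _
      rw [toksIn_fresh hL]
      exact mem_derived (.itemEx (C := .top) (by simp [hq])) (by simp)⟩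
    have h2 : numbers K (queryToks (.rr R A) m) = (m ++ [(Tok.fresh []).number K]).toFinset := by
      rw [hnum, hq]
      simp [itemToks, Concept.asName, Concept.asEx]
    have h3 := h1 h2.ge
    change Fact.ext _ _ (toksIn K _ (m ++ _).toFinset) ∈ _ at h3
    rw [← h2, hself] at h3
    exact ⟨_, by simp [goals, DLAxiom.asRr], h3⟩
  | ca A a =>
    have hq : queryItems (.ca A a) = [] := by
      simp [queryItems, queryConcepts, DLAxiom.asGci, DLAxiom.asRi, DLAxiom.asRr]
    rw [hq] at hnum
    simp only [List.flatMap_nil, List.map_nil, List.append_nil] at hnum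
    have h3 := hsat hnum.ge
    change Fact.ext _ _ (toksIn K _ m.toFinset) ∈ _ at h3
    rw [← hnum, hself, ind_derivedModel (Or.inr (by simp [axiomInds, DLAxiom.asCa]))] at h3
    exact ⟨_, by simp [goals, DLAxiom.asCa], h3⟩
  | ra R a c =>
    have hq : queryItems (.ra R a c) = [] := by
      simp [queryItems, queryConcepts, DLAxiom.asGci, DLAxiom.asRi, DLAxiom.asRr]
    rw [hq] at hnum
    simp only [List.flatMap_nil, List.map_nil, List.append_nil] at hnum
    have h3 := hsat hnum.ge
    change Fact.role _ _ _ (toksIn K _ m.toFinset) ∈ _ at h3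
    rw [← hnum, hself, ind_derivedModel (Or.inr (by simp [axiomInds, DLAxiom.asRa])),
      ind_derivedModel (Or.inr (by simp [axiomInds, DLAxiom.asRa]))] at h3
    exact ⟨_, by simp [goals, DLAxiom.asRa], h3⟩

/-! ### Running time -/

theorem length_allSublists (L : List Tok) : (allSublists L).length = 2 ^ L.length := by
  induction L with
  | nil => rfl
  | cons t L ih =>
    change (allSublists L ++ (allSublists L).map fun b => t :: b).length = _
    rw [List.length_append, List.length_map, ih, List.length_cons, pow_succ]
    ring

theorem sz_map_cons (t : Tok) (B : List (List Tok)) :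
    sz (B.map fun b => t :: b) = sz B + B.length * sz t := by
  induction B with
  | nil => simp [sz_nil]
  | cons b B ih =>
    rw [List.map_cons, sz_cons, sz_cons, sz_cons, ih, List.length_cons]
    ring

theorem sz_allSublists_le (L : List Tok) : sz (allSublists L) ≤ 2 ^ L.length * sz L + 2 := by
  induction L with
  | nil => exact le_rfl
  | cons t L ih =>
    have h1 := sz_append (allSublists L) ((allSublists L).map fun b => t :: b)
    rw [sz_map_cons, length_allSublists] at h1
    change sz (allSublists L ++ (allSublists L).map fun b => t :: b) ≤ _
    rw [sz_cons, List.length_cons, pow_succ]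
    have : 2 ^ L.length * 2 * (sz t + sz L) =
      2 * (2 ^ L.length * sz t) + 2 * (2 ^ L.length * sz L) := by ring
    omega

/-- The list of all sublists is computed in time polynomial in its size. -/
theorem exists_prog_allSublists : ∃ (P : Prog) (k : ℕ), ∀ L : List Tok,
    ∃ t ≤ (2 ^ L.length * sz L + 2) ^ k,
      Runs P (enc ((), [([] : List Tok)], L.reverse)) (enc (allSublists L)) t := by
  -- Each step doubles the accumulator, so `Poly.foldl` does not apply. The general fold is used
  -- with an exponential size bound `M` instead.
  obtain ⟨P, k, hP⟩ := Poly.exists_foldl (γ := Unit)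
    (step := fun _ (B : List (List Tok)) (t : Tok) => B ++ B.map fun b => t :: b) (by fun_prop)
  refine ⟨P, k, fun L => ?_⟩
  have hfold (l : List Tok) : l.foldl (fun B t => B ++ B.map fun b => t :: b) [[]] =
      allSublists l.reverse := by
    rw [allSublists, List.foldr_reverse]
  have h1 : sz L ≤ 2 ^ L.length * sz L := Nat.le_mul_of_pos_left _ (by positivity)
  have h2 := two_le_sz L
  obtain ⟨t, ht, hr⟩ := hP () [[]] L.reverse (2 ^ L.length * sz L + 2)
    (fun i => by
      rw [hfold]
      refine (sz_allSublists_le _).trans (Nat.add_le_add_right (Nat.mul_le_mul ?_ ?_) 2)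
      · refine Nat.pow_le_pow_right (by norm_num) ?_
        simp
      · rw [sz_reverse, ← sz_reverse L]
        exact sz_le_of_sublist (List.take_sublist i _))
    (by rw [sz_reverse]; omega) (Nat.le_add_left _ _)
  rw [hfold, List.reverse_reverse] at hr
  exact ⟨t, ht, hr⟩

/-- The input of the decision problem, with the annotations as monomials. -/
def annotated (O : Ontology) : List (DLAxiom × Monomial) := O.map fun p => (p.1, annMonomial p.2)

/-- The unit component is encoded as the `nil` that closes the list of three inputs, so the nested
tuple is the same tree. -/
theorem inputEnc_eq (O : Ontology) (α : DLAxiom) (m : Monomial) :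
    inputEnc O α m = enc (annotated O, α, m, ()) := by
  simp [inputEnc, enc, ontEnc, monEnc, Data.ofList, annotated]
  rfl

theorem exists_prog_decideEntails : ∃ (P : Prog) (k : ℕ), ∀ (O : List (DLAxiom × Monomial))
    (α : DLAxiom) (m : Monomial),
    ∃ t ≤ (sz (O, α, m, ()) * 2 ^ (queryToks α m).length) ^ k,
      Runs P (enc (O, α, m, ()))
        (enc (decideEntails O α (queryToks α m) (allSublists (queryToks α m)))) t := by
  have h1 : Poly fun x : List (DLAxiom × Monomial) × DLAxiom × Monomial × Unit =>
      ((x.1, x.2.1, queryToks x.2.1 x.2.2.1),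
        ((), [([] : List Tok)], (queryToks x.2.1 x.2.2.1).reverse)) := by
    have hL : Poly fun x : List (DLAxiom × Monomial) × DLAxiom × Monomial × Unit =>
        queryToks x.2.1 x.2.2.1 := Poly.id.snd.fst.queryToks Poly.id.snd.snd.fst
    exact (Poly.id.fst.pair (Poly.id.snd.fst.pair hL)).pair
      ((Poly.const () trivial).pair (Poly.nil.singleton.pair hL.reverse))
  have h3 : Poly fun x : (List (DLAxiom × Monomial) × DLAxiom × List Tok) × List (List Tok) =>
      decideEntails x.1.1 x.1.2.1 x.1.2.2 x.2 :=
    Poly.decideEntails Poly.id.fst.fst Poly.id.fst.snd.fst Poly.id.fst.snd.snd Poly.id.snd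
  obtain ⟨P₁, k₁, hP₁⟩ := h1
  obtain ⟨P₂, k₂, hP₂⟩ := exists_prog_allSublists
  obtain ⟨P₃, k₃, hP₃⟩ := h3
  -- With `W` the input size times 2^|L|, the power `V = W ^ (k₁ + 2)` bounds the output of the
  -- first stage and the size of the list of sublists. The stages take at most `V`, `V ^ k₂` and `V
  -- ^ (2 * k₃)` steps. The summand 6 in the exponent absorbs adding these three and the six
  -- sequencing steps.
  refine ⟨.seq P₁ (.seq (.pair .hd (.seq .tl P₂)) P₃),
    (k₁ + 2) * (k₂ + 2 * k₃ + 6), fun O α m => ?_⟩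
  obtain ⟨hs, t₁, ht₁, hr₁⟩ := hP₁ (O, α, m, ())
  obtain ⟨t₂, ht₂, hr₂⟩ := hP₂ (queryToks α m)
  obtain ⟨-, t₃, ht₃, hr₃⟩ := hP₃ ((O, α, queryToks α m), allSublists (queryToks α m))
  refine ⟨t₁ + ((1 + (1 + t₂ + 1) + 1) + t₃ + 1) + 1, ?_,
    .seq hr₁ (.seq (.pair (.hd _) (.seq (.tl _) hr₂)) hr₃)⟩
  have h2 := two_le_sz (O, α, m, ())
  have hB := sz_allSublists_le (queryToks α m)
  have hs' : sz O + (sz α + sz (queryToks α m)) + (2 + (4 + sz (queryToks α m).reverse)) ≤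
    sz (O, α, m, ()) ^ k₁ := hs
  simp only [sz_pair] at ht₃
  have hsL : sz (queryToks α m) ≤ sz (O, α, m, ()) ^ k₁ := by omega
  have hsx : sz O + (sz α + sz (queryToks α m)) ≤ sz (O, α, m, ()) ^ k₁ := by omega
  generalize sz (O, α, m, ()) = s at *
  generalize sz O + (sz α + sz (queryToks α m)) = r at *
  generalize sz (queryToks α m) = l at *
  generalize (queryToks α m).length = n at *
  generalize sz (allSublists (queryToks α m)) = u at *
  have hn : 1 ≤ 2 ^ n := Nat.one_le_two_pow
  have hsW : s ≤ s * 2 ^ n := Nat.le_mul_of_pos_right _ hn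
  have hnW : 2 ^ n ≤ s * 2 ^ n := Nat.le_mul_of_pos_left _ (by omega)
  rw [pow_mul]
  generalize hW : s * 2 ^ n = W at *
  have hV1 : W * W ^ k₁ + 2 ≤ W ^ (k₁ + 2) := by
    have h5 : 1 ≤ W ^ k₁ := Nat.one_le_pow _ _ (by omega)
    rw [pow_add]
    have h6 : W * 2 ≤ W * W := Nat.mul_le_mul_left _ (by omega)
    have h7 : W * 1 ≤ W * W ^ k₁ := Nat.mul_le_mul_left _ h5
    calc W * W ^ k₁ + 2 ≤ W ^ k₁ * (W * 2) := by nlinarith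
      _ ≤ W ^ k₁ * W ^ 2 := by rw [sq]; exact Nat.mul_le_mul_left _ h6
  have hsV : s ^ k₁ ≤ W ^ (k₁ + 2) := (Nat.pow_le_pow_left hsW k₁).trans
    (Nat.pow_le_pow_right (by omega) (by omega))
  have hM : 2 ^ n * l + 2 ≤ W ^ (k₁ + 2) := by
    have := Nat.mul_le_mul hnW (hsL.trans (Nat.pow_le_pow_left hsW k₁))
    omega
  have hV2 : 2 ≤ W ^ (k₁ + 2) := by omega
  generalize W ^ (k₁ + 2) = V at *
  have e1 : t₁ ≤ V ^ (k₂ + 2 * k₃ + 4) := (ht₁.trans hsV).trans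
    ((pow_one V).ge.trans (Nat.pow_le_pow_right (by omega) (by omega)))
  have e2 : t₂ ≤ V ^ (k₂ + 2 * k₃ + 4) := (ht₂.trans (Nat.pow_le_pow_left hM k₂)).trans
    (Nat.pow_le_pow_right (by omega) (by omega))
  have e3 : t₃ ≤ V ^ (k₂ + 2 * k₃ + 4) := by
    have h6 : r + u ≤ V ^ 2 := by nlinarith
    refine (ht₃.trans (Nat.pow_le_pow_left h6 k₃)).trans ?_
    rw [← pow_mul]
    exact Nat.pow_le_pow_right (by omega) (by omega)
  have e4 : 6 ≤ V ^ (k₂ + 2 * k₃ + 4) := by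
    have h7 : 2 ^ 4 ≤ V ^ 4 := Nat.pow_le_pow_left hV2 4
    have h8 : V ^ 4 ≤ V ^ (k₂ + 2 * k₃ + 4) := Nat.pow_le_pow_right (by omega) (by omega)
    omega
  have e5 : V ^ (k₂ + 2 * k₃ + 4) * 4 ≤ V ^ (k₂ + 2 * k₃ + 6) := by
    rw [pow_add V (k₂ + 2 * k₃ + 4) 2]
    exact Nat.mul_le_mul_left _ (by nlinarith)
  omega

/-! ### Encoded sizes against string lengths -/

theorem sz_concept_le (C : Concept) : sz C ≤ 12 * C.size := by
  induction C with
  | top => simp [sz, enc, Concept.enc, Data.size, Concept.size, Data.node, Data.num, Data.ofList]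
  | name A =>
    simp [sz, enc, Concept.enc, Data.size, Concept.size, Data.node, Data.num, Data.ofList]
  | conj C D ihC ihD =>
    have : sz (Concept.conj C D) = 6 + (sz C + (sz D + 2)) := rfl
    rw [this, Concept.size]
    omega
  | ex R C ih =>
    have : sz (Concept.ex R C) = 8 + (2 + (sz C + 2)) := rfl
    rw [this, Concept.size]
    omega

theorem sz_rhsConcept_le (D : RhsConcept) : sz D ≤ 12 * D.size := by
  cases D <;> simp [sz, enc, RhsConcept.enc, Data.size, RhsConcept.size, Data.node, Data.num,
    Data.ofList]

theorem sz_dlAxiom_le (α : DLAxiom) : sz α ≤ 12 * α.size := by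
  cases α with
  | gci C D =>
    have : sz (DLAxiom.gci C D) = 2 + (sz C + (sz D + 2)) := rfl
    have := sz_concept_le C
    have := sz_rhsConcept_le D
    rw [DLAxiom.size]
    omega
  | _ => simp [sz, enc, DLAxiom.enc, Data.size, DLAxiom.size, Data.node, Data.num, Data.ofList]

theorem sz_annotated_le (O : Ontology) : sz (annotated O) ≤ 12 * ontSize O := by
  induction O with
  | nil => simp [annotated, sz_nil, ontSize]
  | cons p O ih =>
    have h1 : sz (annMonomial p.2) ≤ 4 := by
      rcases p with ⟨a, _ | v⟩
      · exact (by norm_num : 2 ≤ 4)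
      · exact (le_rfl : 4 ≤ 4)
    have h2 := sz_dlAxiom_le p.1
    change sz ((p.1, annMonomial p.2) :: annotated O) ≤ _
    rw [sz_cons, sz_pair]
    simp only [ontSize, List.map_cons, List.sum_cons] at ih ⊢
    omega

theorem length_le_monSize (m : Monomial) : m.length ≤ monSize m := by
  induction m with
  | nil => simp
  | cons v m ih =>
    cases m with
    | nil => simp [monSize]
    | cons u m =>
      rw [monSize, List.length_cons]
      omega

theorem one_le_monSize (m : Monomial) : 1 ≤ monSize m := by
  cases m with
  | nil => simp [monSize]
  | cons v m => exact le_trans (by simp) (length_le_monSize _)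

theorem sz_monomial (m : Monomial) : sz m = 2 * m.length + 2 := by
  induction m with
  | nil => rfl
  | cons v m ih =>
    have : sz v = 2 := rfl
    rw [sz_cons, ih, this, List.length_cons]
    ring

theorem length_conceptToks_le (C : Concept) (p e : List Bool) :
    (conceptToks C p e).length ≤ C.size := by
  induction C generalizing p e with
  | top => simp [conceptToks, positions, itemToks, Concept.asName, Concept.asEx]
  | name A => simp [conceptToks, positions, itemToks, Concept.asName, Concept.asEx, Concept.size]
  | conj C D ihC ihD =>
    have h : conceptToks (.conj C D) p e =
        conceptToks C (false :: p) e ++ conceptToks D (true :: p) e := by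
      simp [conceptToks, positions, itemToks, Concept.asName, Concept.asEx]
    rw [h, List.length_append, Concept.size]
    have := ihC (false :: p) e
    have := ihD (true :: p) e
    omega
  | ex R C ih =>
    have h : conceptToks (.ex R C) p e =
        .fresh p :: conceptToks C (false :: p) (false :: p) := by
      simp [conceptToks, positions, itemToks, Concept.asName, Concept.asEx]
    rw [h, List.length_cons, Concept.size]
    have := ih (false :: p) (false :: p)
    omega

theorem length_queryToks_le (α : DLAxiom) (m : Monomial) :
    (queryToks α m).length ≤ monSize m + α.size := by
  rw [queryToks, List.length_append, List.length_map]
  refine Nat.add_le_add (length_le_monSize m) ?_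
  cases α with
  | gci C D =>
    have := length_conceptToks_le C [] []
    simp only [conceptToks] at this
    simp only [queryItems, queryConcepts, DLAxiom.asGci, DLAxiom.asRi, DLAxiom.asRr, List.map_cons,
      List.map_nil, List.append_nil, List.flatMap_cons, List.flatMap_nil, DLAxiom.size]
    omega
  | _ =>
    simp [queryItems, queryConcepts, DLAxiom.asGci, DLAxiom.asRi, DLAxiom.asRr, positions,
      itemToks, Concept.asName, Concept.asEx, DLAxiom.size]

theorem entails_iff_decideEntails (O : Ontology) (α : DLAxiom) (m : Monomial) :
    decideEntails (annotated O) α (queryToks α m) (allSublists (queryToks α m)) = true ↔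
      Entails O α m := by
  have hmodel (I : Interp) : (∀ p ∈ annotated O, I.Sat p.1 p.2) ↔ I.IsModel O := by
    simp only [annotated, Interp.IsModel, List.forall_mem_map]
  refine ⟨fun h I hI => entails_of_decideEntails h I ((hmodel I).2 hI), fun h => ?_⟩
  exact decideEntails_of_entails fun I hI => h I ((hmodel I).1 hI)

end ELHr

theorem mainTheorem7 :
    ∃ (P : ELHr.Prog) (c : ℕ),
      ∀ (O : ELHr.Ontology) (α : ELHr.DLAxiom) (m : ELHr.Monomial),
        ∃ (b : Bool) (t : ℕ),
          ELHr.Runs P (ELHr.inputEnc O α m) (ELHr.Data.ofBool b) t ∧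
          (b = true ↔ ELHr.Entails O α m) ∧
          t ≤ c * (ELHr.ontSize O + α.size) ^ c * 2 ^ (c * (ELHr.monSize m + α.size)) := by
  open ELHr in
  obtain ⟨P, k, hP⟩ := exists_prog_decideEntails
  -- The summand `20 ^ k` covers the leading constant; `2 * k` covers both the degree `k` and the
  -- factor in the exponent of 2.
  refine ⟨P, 20 ^ k + 2 * k, fun O α m => ?_⟩
  obtain ⟨t, ht, hr⟩ := hP (annotated O) α m
  refine ⟨_, t, inputEnc_eq O α m ▸ hr, entails_iff_decideEntails O α m, ht.trans ?_⟩
  have h1 := sz_annotated_le O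
  have h2 := sz_dlAxiom_le α
  have h3 := sz_monomial m
  have h4 := length_le_monSize m
  have h5 := one_le_monSize m
  have h6 := length_queryToks_le α m
  have h7 : 1 ≤ ontSize O := Nat.le_add_right _ _
  have h8 : sz (annotated O, α, m, ()) =
    sz (annotated O) + (sz α + (sz m + 2)) := rfl
  -- The part of the input size that depends on `m` is absorbed into the exponential, doubling its
  -- exponent and leaving only `|O| + |α|` in the polynomial factor.
  have h9 : monSize m + α.size ≤ 2 ^ (monSize m + α.size) := Nat.lt_two_pow_self.le
  have hN : 1 ≤ ontSize O + α.size := by omega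
  have hX : 1 ≤ monSize m + α.size := by omega
  have h10 : sz (annotated O, α, m, ()) ≤
      20 * (ontSize O + α.size) * (monSize m + α.size) := by
    have : sz (annotated O, α, m, ()) ≤
        12 * (ontSize O + α.size) + 6 * (monSize m + α.size) := by omega
    nlinarith
  generalize ontSize O + α.size = N at *
  generalize monSize m + α.size = X at *
  have h11 : sz (annotated O, α, m, ()) * 2 ^ (queryToks α m).length ≤
      20 * N * 2 ^ (2 * X) := by
    calc sz (annotated O, α, m, ()) * 2 ^ (queryToks α m).length
        ≤ 20 * N * 2 ^ X * 2 ^ X :=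
          Nat.mul_le_mul (h10.trans (Nat.mul_le_mul_left _ h9))
            (Nat.pow_le_pow_right (by norm_num) h6)
      _ = 20 * N * 2 ^ (2 * X) := by rw [two_mul, pow_add]; ring
  refine (Nat.pow_le_pow_left h11 k).trans ?_
  rw [mul_pow, mul_pow, ← pow_mul]
  generalize 20 ^ k = a
  refine Nat.mul_le_mul (Nat.mul_le_mul (by omega) (Nat.pow_le_pow_right hN ?_))
    (Nat.pow_le_pow_right (by norm_num) ?_)
  · omega
  · calc 2 * X * k = 2 * k * X := by ring
      _ ≤ (a + 2 * k) * X := Nat.mul_le_mul_right _ (by omega)
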